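/- Let $F$ be a field of characteristic two and let $E/F$ be a finite Galois extension of odd degree $n=2m+1$ with group $G=\mathrm{Gal}(E/F)$. Let $\Phi:G\times G\to E^\times$ be a $2$-cocycle and let $A=(E,G,\Phi)=\bigoplus_{\sigma\in G}E\,u_\sigma$ be the crossed product, with multiplication given by $u_\sigma c=\sigma(c)u_\sigma$ for $c\in E$ and $u_\sigma u_\tau=\Phi(\sigma,\tau)u_{\sigma\tau}$; it is a central simple $F$-algebra of degree $n$. For $a\in A$ write the reduced characteristic polynomial of $a$ as $X^n-t_1(a)X^{n-1}+t_2(a)X^{n-2}-\cdots+(-1)^nt_n(a)\in F[X]$ (with $t_2=0$ if $n=1$), and let $T_{A/F}$ be the quadratic form $t_2$ restricted to $A_0=\ker t_1$. Let $[a,b]$ denote the binary quadratic form $ax^2+xy+by^2$, let $\mathbb H=[0,0]$ be the hyperbolic plane, let $+$ denote orthogonal sum, and call two quadratic forms over $F$ Witt equivalent if they become isometric after adding suitable numbers of hyperbolic planes. Then $T_{A/F}$ is Witt equivalent to $$\begin{cases} m\,\mathbb H & \text{if } n\equiv 1,7 \pmod 8,\\ [1,1]+(m-1)\,\mathbb H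 & \text{if } n\equiv 3,5 \pmod 8.\end{cases}$$ More precisely, $T_{A/F}$ is isometric to $m\mathbb H+mn\,\mathbb H$ if $n\equiv 1,7\pmod 8$, and to $[1,1]+(m-1)\mathbb H+mn\,\mathbb H$ if $n\equiv 3,5\pmod 8$. -/

import Mathlib

open scoped TensorProduct
open groupCohomology

universe u v

noncomputable section

/-! ### Crossed products -/

section CrossedProduct

set_option linter.unusedSectionVars false

variable {F : Type u} {E : Type v} [Field F] [Field E] [Algebra F E] [FiniteDimensional F E]
  {Φ : Gal(E/F) × Gal(E/F) → Eˣ}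

/-- The crossed product `(E, Gal(E/F), Φ)` of a 2-cocycle `Φ : G × G → Eˣ`: the `E`-vector space
with basis `u σ`, `σ ∈ G = Gal(E/F)`; the function `x : G → E` stands for `∑ σ, x σ • u σ`.
The product is determined by
`u σ * c = σ c * u σ` for `c ∈ E`, and `u σ * u τ = Φ (σ, τ) * u (σ τ)`. -/
def CrossedProduct (_hΦ : IsMulCocycle₂ Φ) : Type v := Gal(E/F) → E

namespace CrossedProduct

variable {hΦ : IsMulCocycle₂ Φ}

instance : AddCommGroup (CrossedProduct hΦ) := inferInstanceAs (AddCommGroup (Gal(E/F) → E))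

instance : Module F (CrossedProduct hΦ) := inferInstanceAs (Module F (Gal(E/F) → E))

@[ext] theorem ext {x y : CrossedProduct hΦ} (h : ∀ σ, x σ = y σ) : x = y := funext h

@[simp] theorem add_apply (x y : CrossedProduct hΦ) (σ : Gal(E/F)) : (x + y) σ = x σ + y σ := rfl

@[simp] theorem zero_apply (σ : Gal(E/F)) : (0 : CrossedProduct hΦ) σ = 0 := rfl

@[simp] theorem smul_apply (c : F) (x : CrossedProduct hΦ) (σ : Gal(E/F)) :
    (c • x) σ = c • x σ := rfl

/-- The product of `∑ σ, x σ • u σ` and `∑ τ, y τ • u τ`; the coefficient of `u ρ` collects the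
pairs `(σ, τ)` with `σ τ = ρ`. -/
instance : Mul (CrossedProduct hΦ) where
  mul x y := fun ρ => ∑ σ : Gal(E/F), x σ * σ (y (σ⁻¹ * ρ)) * (Φ (σ, σ⁻¹ * ρ) : E)

open Classical in
/-- The element `c • u σ`. -/
def single (hΦ : IsMulCocycle₂ Φ) (σ : Gal(E/F)) (c : E) : CrossedProduct hΦ := Pi.single σ c

/-- The unit element is `Φ(1,1)⁻¹ • u 1`. -/
instance : One (CrossedProduct hΦ) where
  one := single hΦ 1 ((Φ (1, 1))⁻¹ : Eˣ)

theorem mul_apply (x y : CrossedProduct hΦ) (ρ : Gal(E/F)) :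
    (x * y) ρ = ∑ σ : Gal(E/F), x σ * σ (y (σ⁻¹ * ρ)) * (Φ (σ, σ⁻¹ * ρ) : E) := rfl

open Classical in
theorem single_apply (σ τ : Gal(E/F)) (c : E) :
    single hΦ σ c τ = if τ = σ then c else 0 := by
  simp [single, Pi.single_apply]

theorem one_def : (1 : CrossedProduct hΦ) = single hΦ 1 ((Φ (1, 1))⁻¹ : Eˣ) := rfl

theorem cocycle_coe (hΦ : IsMulCocycle₂ Φ) (g h j : Gal(E/F)) :
    (Φ (g * h, j) : E) * (Φ (g, h) : E) = g (Φ (h, j) : E) * (Φ (g, h * j) : E) := by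
  have := congrArg (Units.val) (hΦ g h j)
  simpa using this

theorem single_mul_single (σ τ : Gal(E/F)) (c d : E) :
    single hΦ σ c * single hΦ τ d = single hΦ (σ * τ) (c * σ d * (Φ (σ, τ) : E)) := by
  classical
  ext ρ
  rw [mul_apply, Finset.sum_eq_single σ]
  · by_cases h : ρ = σ * τ
    · subst h; simp [single_apply]
    · have h' : ¬ σ⁻¹ * ρ = τ := fun h' => h (by rw [← h']; simp)
      simp [single_apply, h, h']
  · intro b _ hb
    simp [single_apply, hb]
  · simp

protected theorem mul_assoc' (x y z : CrossedProduct hΦ) : x * y * z = x * (y * z) := by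
  ext ρ
  simp only [mul_apply, Finset.sum_mul, map_sum, Finset.mul_sum, map_mul]
  rw [Finset.sum_comm]
  refine Finset.sum_congr rfl fun σ _ => ?_
  rw [← Equiv.sum_comp (Equiv.mulLeft σ)]
  refine Finset.sum_congr rfl fun τ _ => ?_
  have h := cocycle_coe hΦ σ τ (τ⁻¹ * (σ⁻¹ * ρ))
  simp only [Equiv.coe_mulLeft, inv_mul_cancel_left, mul_inv_rev, mul_assoc,
    mul_inv_cancel_left, AlgEquiv.mul_apply] at h ⊢
  linear_combination (x σ * σ (y τ) * σ (τ (z (τ⁻¹ * (σ⁻¹ * ρ))))) * h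

protected theorem one_mul' (x : CrossedProduct hΦ) : 1 * x = x := by
  classical
  ext ρ
  rw [mul_apply, Finset.sum_eq_single 1]
  · have h : Φ (1, ρ) = Φ (1, 1) := map_one_fst_of_isMulCocycle₂ hΦ ρ
    simp only [one_def, single_apply, if_true, inv_one, one_mul, AlgEquiv.one_apply, h]
    rw [mul_right_comm, Units.inv_mul, one_mul]
  · intro b _ hb
    simp [one_def, single_apply, hb]
  · simp

protected theorem mul_one' (x : CrossedProduct hΦ) : x * 1 = x := by
  classical
  ext ρ
  rw [mul_apply, Finset.sum_eq_single ρ]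
  · have h : Φ (ρ, 1) = ρ • Φ (1, 1) := map_one_snd_of_isMulCocycle₂ hΦ ρ
    have h' : (Φ (ρ, 1) : E) = ρ (Φ (1, 1) : E) := by simpa using congrArg Units.val h
    simp only [one_def, single_apply, if_true, inv_mul_cancel, h']
    rw [mul_assoc, ← map_mul, Units.inv_mul, map_one, mul_one]
  · intro b _ hb
    have : ¬ b⁻¹ * ρ = 1 := fun h => hb (inv_mul_eq_one.mp h)
    simp [one_def, single_apply, this]
  · simp

instance : Ring (CrossedProduct hΦ) where
  __ := (inferInstance : AddCommGroup (CrossedProduct hΦ))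
  left_distrib x y z := by
    ext; simp [mul_apply, mul_add, add_mul, Finset.sum_add_distrib]
  right_distrib x y z := by
    ext; simp [mul_apply, add_mul, Finset.sum_add_distrib]
  zero_mul x := by ext; simp [mul_apply]
  mul_zero x := by ext; simp [mul_apply]
  mul_assoc := CrossedProduct.mul_assoc'
  one_mul := CrossedProduct.one_mul'
  mul_one := CrossedProduct.mul_one'

instance : Algebra F (CrossedProduct hΦ) := Algebra.ofModule
  (fun r x y => by ext; simp [mul_apply, Finset.smul_sum])
  (fun r x y => by ext; simp [mul_apply, Finset.smul_sum])

end CrossedProduct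

end CrossedProduct

/-! ### The reduced characteristic polynomial and the second trace form -/

section Reduced

variable (F : Type u) (A : Type v) [Field F] [Ring A] [Algebra F A]

/-- The degree of a central simple algebra: the `n` with `dim_F A = n ^ 2`. -/
def csaDegree : ℕ := Nat.sqrt (Module.finrank F A)

/-- A splitting of `A` over the algebraic closure `K` of `F` (which splits every central simple
algebra over `F`): an isomorphism `K ⊗ A ≃ M_n(K)`, with `n` the degree of `A`. The corresponding
splitting representation is `a ↦ φ (1 ⊗ a)`. -/
abbrev Splitting : Type _ :=
  AlgebraicClosure F ⊗[F] A ≃ₐ[AlgebraicClosure F]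
    Matrix (Fin (csaDegree F A)) (Fin (csaDegree F A)) (AlgebraicClosure F)

/-- An `F`-linear retraction of `F → K`. It is only used to read elements of `K` that lie in `F` as
elements of `F`. -/
def retractToBase : AlgebraicClosure F →ₗ[F] F :=
  (LinearMap.exists_leftInverse_of_injective (Algebra.linearMap F (AlgebraicClosure F))
    (LinearMap.ker_eq_bot.mpr (algebraMap F (AlgebraicClosure F)).injective)).choose

theorem retractToBase_algebraMap (c : F) :
    retractToBase F (algebraMap F (AlgebraicClosure F) c) = c :=
  LinearMap.congr_fun
    (LinearMap.exists_leftInverse_of_injective (Algebra.linearMap F (AlgebraicClosure F))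
      (LinearMap.ker_eq_bot.mpr (algebraMap F (AlgebraicClosure F)).injective)).choose_spec c

/-- The splitting representation `A → M_n(K)`, for a chosen splitting (and zero if there is none,
which does not happen for central simple algebras). -/
def splittingRep : A →ₗ[F]
    Matrix (Fin (csaDegree F A)) (Fin (csaDegree F A)) (AlgebraicClosure F) :=
  open Classical in
  if h : Nonempty (Splitting F A) then
    ((h.some.toAlgHom.restrictScalars F).comp
      (Algebra.TensorProduct.includeRight : A →ₐ[F] AlgebraicClosure F ⊗[F] A)).toLinearMap
  else 0

variable {A}

/-- The reduced characteristic polynomial `det (X - φ(a))` of `a`, as a polynomial over `F`: for a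
central simple algebra its coefficients lie in `F`, and it does not depend on `φ`. -/
def reducedCharpoly (a : A) : Polynomial F :=
  ∑ i ∈ Finset.range (csaDegree F A + 1),
    Polynomial.monomial i (retractToBase F ((splittingRep F A a).charpoly.coeff i))

/-- `t_i(a)`, where
`X ^ n - t_1(a) X ^ (n - 1) + t_2(a) X ^ (n - 2) - ⋯ + (-1) ^ n t_n(a)` is the reduced
characteristic polynomial of `a`; it is zero for `i > n`. -/
def reducedCoeff (i : ℕ) (a : A) : F :=
  if i ≤ csaDegree F A then (-1) ^ i * (reducedCharpoly F a).coeff (csaDegree F A - i) else 0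

theorem reducedCoeff_of_le {i : ℕ} (hi : i ≤ csaDegree F A) (a : A) :
    reducedCoeff F i a =
      (-1) ^ i * retractToBase F ((splittingRep F A a).charpoly.coeff (csaDegree F A - i)) := by
  rw [reducedCoeff, if_pos hi, reducedCharpoly, Polynomial.finsetSum_coeff]
  simp [Polynomial.coeff_monomial]

variable (A)

/-- The reduced trace `t_1`, as a linear form. -/
def reducedTrace : A →ₗ[F] F where
  toFun := reducedCoeff F 1
  map_add' x y := by
    by_cases h : 1 ≤ csaDegree F A
    · have : Nonempty (Fin (csaDegree F A)) := ⟨⟨0, h⟩⟩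
      have key (z : A) : reducedCoeff F 1 z = retractToBase F (splittingRep F A z).trace := by
        rw [reducedCoeff_of_le F h, Matrix.trace_eq_neg_charpoly_coeff]
        simp
      simp [key]
    · simp [reducedCoeff, h]
  map_smul' c x := by
    by_cases h : 1 ≤ csaDegree F A
    · have : Nonempty (Fin (csaDegree F A)) := ⟨⟨0, h⟩⟩
      have key (z : A) : reducedCoeff F 1 z = retractToBase F (splittingRep F A z).trace := by
        rw [reducedCoeff_of_le F h, Matrix.trace_eq_neg_charpoly_coeff]
        simp
      simp [key]
    · simp [reducedCoeff, h]

theorem exists_quadraticMap_charpoly_coeff {K : Type*} [Field K] (n : ℕ) (hn : 2 ≤ n) :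
    ∃ q : QuadraticForm K (Matrix (Fin n) (Fin n) K), ∀ M, q M = M.charpoly.coeff (n - 2) := by
  have key (s : Finset (Fin n)) : ∃ q : QuadraticForm K (Matrix (Fin n) (Fin n) K),
      s.card = 2 → ∀ M : Matrix (Fin n) (Fin n) K,
        q M = (M.submatrix (Subtype.val : s → Fin n) (Subtype.val : s → Fin n)).det := by
    by_cases hs : s.card = 2
    · let e : Fin 2 ≃ s := (s.equivFinOfCardEq hs).symm
      let l (i j : Fin n) : Matrix (Fin n) (Fin n) K →ₗ[K] K := Matrix.entryLinearMap K K i j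
      refine ⟨QuadraticMap.linMulLin (l (e 0) (e 0)) (l (e 1) (e 1)) -
        QuadraticMap.linMulLin (l (e 0) (e 1)) (l (e 1) (e 0)), fun _ M => ?_⟩
      rw [← Matrix.det_submatrix_equiv_self e, Matrix.det_fin_two]
      simp [l]
    · exact ⟨0, fun h => absurd h hs⟩
  choose q hq using key
  refine ⟨∑ s ∈ Finset.univ.powersetCard 2, q s, fun M => ?_⟩
  have h := Matrix.charpoly_coeff_eq_sum_minors M 2 (by simpa using hn)
  rw [Fintype.card_fin] at h
  rw [h, sum_apply]
  simp only [even_two, Even.neg_pow, one_pow, one_mul]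
  exact Finset.sum_congr rfl fun s hs => hq s (Finset.mem_powersetCard.mp hs).2 M

theorem exists_quadraticForm_reducedCoeff :
    ∃ q : QuadraticForm F A, ∀ a, q a = reducedCoeff F 2 a := by
  by_cases h : 2 ≤ csaDegree F A
  · obtain ⟨q, hq⟩ := exists_quadraticMap_charpoly_coeff
      (K := AlgebraicClosure F) (csaDegree F A) h
    refine ⟨(retractToBase F).compQuadraticMap
      ((q.restrictScalars (S := F)).comp (splittingRep F A)), fun a => ?_⟩
    rw [reducedCoeff_of_le F h]
    simp [hq]
  · exact ⟨0, fun a => by simp [reducedCoeff, h]⟩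

/-- The quadratic form `t_2` on `A`. -/
def reducedSecondTrace : QuadraticForm F A where
  toFun := reducedCoeff F 2
  toFun_smul c a := by
    obtain ⟨q, hq⟩ := exists_quadraticForm_reducedCoeff F A
    simp only [← hq, QuadraticMap.map_smul]
  exists_companion' := by
    obtain ⟨q, hq⟩ := exists_quadraticForm_reducedCoeff F A
    obtain ⟨B, hB⟩ := q.exists_companion
    exact ⟨B, fun x y => by simp only [← hq, hB]⟩

/-- The space of `T_{A/F}`: all of `A` if the degree is even, `A_0 = ker t_1` if it is odd. -/
def secondTraceSpace : Submodule F A :=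
  if Even (csaDegree F A) then ⊤ else LinearMap.ker (reducedTrace F A)

/-- The (reduced) second trace form `T_{A/F}`: the form `t_2` on `A` if the degree of `A` is even,
on `A_0 = ker t_1` if the degree is odd. -/
def secondTraceForm : QuadraticForm F (secondTraceSpace F A) :=
  (reducedSecondTrace F A).comp (secondTraceSpace F A).subtype

end Reduced

/-! ### Binary forms, hyperbolic spaces and Witt equivalence -/

section Forms

variable {F : Type u} [Field F]

/-- The binary quadratic form `[a, b] = a x ^ 2 + x y + b y ^ 2`. -/
def binaryForm (a b : F) : QuadraticForm F (F × F) :=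
  a • QuadraticMap.linMulLin (LinearMap.fst F F F) (LinearMap.fst F F F) +
    QuadraticMap.linMulLin (LinearMap.fst F F F) (LinearMap.snd F F F) +
    b • QuadraticMap.linMulLin (LinearMap.snd F F F) (LinearMap.snd F F F)

theorem binaryForm_apply (a b x y : F) :
    binaryForm a b (x, y) = a * x ^ 2 + x * y + b * y ^ 2 := by
  simp [binaryForm]; ring

variable (F) in
/-- The orthogonal sum `k ℍ` of `k` hyperbolic planes `ℍ = [0, 0]`. -/
def hyperbolicForm (k : ℕ) : QuadraticForm F (Fin k → F × F) :=
  QuadraticMap.pi fun _ => binaryForm 0 0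

/-- Witt equivalence of quadratic forms: they become isometric after adding hyperbolic planes. -/
def WittEquivalent {V : Type*} {W : Type*} [AddCommGroup V] [Module F V] [AddCommGroup W]
    [Module F W] (q : QuadraticForm F V) (r : QuadraticForm F W) : Prop :=
  ∃ k l : ℕ, (q.prod (hyperbolicForm F k)).Equivalent (r.prod (hyperbolicForm F l))

end Forms

end

/-! ### Totally singular subspaces -/

section Lagrangian

open Module

set_option linter.unusedSectionVars false

/-! Write a Lagrangian for a totally singular subspace of half the dimension. The argument splits
off the hyperbolic part `mn ℍ`, then finds a Lagrangian for what remains, over `E`, and brings it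
down to `F`.

Splitting off. As `n` is odd, `G` has no involution, so `G \ {1}` is the disjoint union of some `S`
and `S⁻¹`. In the regular representation over `E` the entries `(σ, τ)` and `(τ, σ)` involve only the
coefficients at `στ⁻¹` and its inverse. If one coefficient of every such pair vanishes, `t_2` is
therefore the second elementary symmetric function of the conjugates of the identity component
(`reducedSecondTrace_of_mul_inv`). Hence `⨁_{σ ∈ S} E u_σ` is totally singular of dimension `mn` and
orthogonal to the copy of the trace-zero part `E₀` of `E`. Comparing dimensions, the form is
`T_{E/F}`, the second trace form on `E₀`, plus `mn ℍ`
(`secondTraceForm_equivalent_conjugatesForm_prod`).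

Descent. Let `α` generate `E/F` and let `s : E → F` read off the coefficient of `1` in the basis `1,
α, …, α^(2m)`. In the transfer along `s` of the extended form, `αV + ⋯ + α^m V` is totally singular,
since all products have exponents between `2` and `2m`, and its orthogonal complement is its sum
with `V`. Reduction modulo it turns a Lagrangian over `E` into one over `F`
(`exists_lagrangian_of_odd_extension`, by `exists_lagrangian_of_reduction`).

Lagrangians over `E`. There `T_{E/F}` becomes the second elementary symmetric function on the
sum-zero vectors of `E^n`. Binary codes with weights divisible by four span totally singular
subspaces. The extended Hamming code of length 8 gives periodicity modulo 8, leaving `n = 1, 7`, and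
`n = 3, 5` after adding `[1,1]`. A Lagrangian of `T_{E/F} + [1,1]` gives `T_{E/F} ≅ [1,1] + (m-1) ℍ`
(`equivalent_binaryForm_prod_of_lagrangian`). -/

theorem nondegenerate_polarBilin {F V : Type*} [Field F] [AddCommGroup V] [Module F V]
    {Q : QuadraticForm F V} (h : ∀ x, (∀ y, QuadraticMap.polar Q x y = 0) → x = 0) :
    Q.polarBilin.Nondegenerate := by
  refine ⟨fun x hx => h x hx, fun x hx => h x fun y => ?_⟩
  rw [QuadraticMap.polar_comm]
  exact hx y

theorem eq_zero_of_polar_eq_zero {F V : Type*} [Field F] [AddCommGroup V] [Module F V]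
    {Q : QuadraticForm F V} (hQ : Q.polarBilin.Nondegenerate) {x : V}
    (h : ∀ y, QuadraticMap.polar Q x y = 0) : x = 0 :=
  hQ.1 x h

theorem polar_eq_zero_of_totallySingular {F V : Type*} [Field F] [AddCommGroup V] [Module F V]
    {Q : QuadraticForm F V} {L : Submodule F V} (hL : ∀ x ∈ L, Q x = 0) {x y : V} (hx : x ∈ L)
    (hy : y ∈ L) : QuadraticMap.polar Q x y = 0 := by
  rw [QuadraticMap.polar, hL _ (L.add_mem hx hy), hL x hx, hL y hy]; simp

theorem map_sum_eq_zero_of_polar {F V ι : Type*} [Field F] [AddCommGroup V] [Module F V]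
    (Q : QuadraticForm F V) (s : Finset ι) (f : ι → V) (h : ∀ i, Q (f i) = 0)
    (h' : ∀ i j, i ≠ j → QuadraticMap.polar Q (f i) (f j) = 0) : Q (∑ i ∈ s, f i) = 0 := by
  classical
  induction s using Finset.induction_on with
  | empty => simp
  | insert a s ha ih =>
    rw [Finset.sum_insert ha, QuadraticMap.map_add (⇑Q), h, ih,
      ← QuadraticMap.polarBilin_apply_apply, map_sum, Finset.sum_eq_zero]
    · simp
    · intro i hi
      exact h' _ _ fun h => ha (h ▸ hi)

variable {F V W : Type*} [Field F] [AddCommGroup V] [Module F V] [FiniteDimensional F V]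
  [AddCommGroup W] [Module F W] [FiniteDimensional F W]

/-- Such an `L` lies in its own orthogonal complement. Only the polar form is required to vanish: in
characteristic two this is weaker than total singularity, and the weaker condition is what
`equivalent_binaryForm_prod_of_anisotropic` can supply. -/
theorem two_mul_finrank_le_of_polar_eq_zero {Q : QuadraticForm F V}
    (hQ : Q.polarBilin.Nondegenerate) {L : Submodule F V}
    (hL : ∀ x ∈ L, ∀ y ∈ L, QuadraticMap.polar Q x y = 0) : 2 * finrank F L ≤ finrank F V := by
  have h1 : L ≤ LinearMap.BilinForm.orthogonal Q.polarBilin L := fun x hx =>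
    LinearMap.BilinForm.mem_orthogonal_iff.mpr fun y hy => hL y hy x hx
  have h2 := Submodule.finrank_mono h1
  rw [LinearMap.BilinForm.finrank_orthogonal hQ] at h2
  have := Submodule.finrank_le L
  omega

theorem injective_of_isometric {Q : QuadraticForm F V} (hQ : Q.polarBilin.Nondegenerate)
    {T : QuadraticForm F W} (g : V →ₗ[F] W) (hg : ∀ v, T (g v) = Q v) :
    Function.Injective g := by
  rw [injective_iff_map_eq_zero]
  intro x hx
  refine eq_zero_of_polar_eq_zero hQ fun y => ?_
  simp only [QuadraticMap.polar, ← hg, map_add, hx]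
  simp

theorem polar_isometric {Q : QuadraticForm F V} {T : QuadraticForm F W} (g : V →ₗ[F] W)
    (hg : ∀ v, T (g v) = Q v) (x y : V) :
    QuadraticMap.polar T (g x) (g y) = QuadraticMap.polar Q x y := by
  simp only [QuadraticMap.polar, ← hg, map_add]

/-- If `N` is totally singular and `N^⊥ = N ⊥ V`, then `V` has a Lagrangian if the whole space
has one. -/
theorem exists_lagrangian_of_reduction {Q : QuadraticForm F V} (hQ : Q.polarBilin.Nondegenerate)
    {T : QuadraticForm F W} (hT : T.polarBilin.Nondegenerate) (g : V →ₗ[F] W)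
    (hg : ∀ v, T (g v) = Q v) {N : Submodule F W} (hN : ∀ x ∈ N, T x = 0)
    (hgN : ∀ v, ∀ x ∈ N, QuadraticMap.polar T (g v) x = 0)
    (hdim : finrank F V + 2 * finrank F N = finrank F W)
    {L : Submodule F W} (hL : ∀ x ∈ L, T x = 0) (hdimL : 2 * finrank F L = finrank F W) :
    ∃ L' : Submodule F V, (∀ x ∈ L', Q x = 0) ∧ 2 * finrank F L' = finrank F V := by
  have hinj := injective_of_isometric hQ g hg
  have hdisj : Disjoint N (LinearMap.range g) := by
    rw [Submodule.disjoint_def]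
    rintro _ hx ⟨v, rfl⟩
    rw [eq_zero_of_polar_eq_zero hQ (x := v), map_zero]
    intro y
    rw [← polar_isometric g hg, QuadraticMap.polar_comm]
    exact hgN y _ hx
  set O := LinearMap.BilinForm.orthogonal T.polarBilin N with hO
  have hM : N ⊔ LinearMap.range g = O := by
    apply Submodule.eq_of_le_of_finrank_eq
    · rw [sup_le_iff]
      constructor
      · intro x hx
        exact LinearMap.BilinForm.mem_orthogonal_iff.mpr fun y hy =>
          polar_eq_zero_of_totallySingular hN hy hx
      · rintro _ ⟨v, rfl⟩
        refine LinearMap.BilinForm.mem_orthogonal_iff.mpr fun y hy => ?_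
        exact (QuadraticMap.polar_comm T _ _).trans (hgN v y hy)
    · have h := Submodule.finrank_sup_add_finrank_inf_eq N (LinearMap.range g)
      rw [hdisj.eq_bot, finrank_bot, LinearMap.finrank_range_of_inj hinj] at h
      rw [hO, LinearMap.BilinForm.finrank_orthogonal hT]
      omega
  -- A Lagrangian is its own orthogonal complement, so `L ∩ N^⊥` contains (indeed is) the complement
  -- of `L + N`; this bounds its dimension from below.
  have hLO : LinearMap.BilinForm.orthogonal T.polarBilin L = L := by
    symm
    apply Submodule.eq_of_le_of_finrank_eq
    · intro x hx
      exact LinearMap.BilinForm.mem_orthogonal_iff.mpr fun y hy =>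
        polar_eq_zero_of_totallySingular hL hy hx
    · rw [LinearMap.BilinForm.finrank_orthogonal hT]
      omega
  have h1 : finrank F W - finrank F ↥(L ⊔ N) ≤ finrank F ↥(L ⊓ O) := by
    rw [← LinearMap.BilinForm.finrank_orthogonal hT]
    apply Submodule.finrank_mono
    refine le_inf ?_ (LinearMap.BilinForm.orthogonal_le le_sup_right)
    conv_rhs => rw [← hLO]
    exact LinearMap.BilinForm.orthogonal_le le_sup_left
  have h2 := Submodule.finrank_sup_add_finrank_inf_eq L N
  have hNO : N ≤ O := hM ▸ le_sup_left
  have h3 := Submodule.finrank_sup_add_finrank_inf_eq (L ⊓ O) N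
  rw [inf_assoc, inf_eq_right.mpr hNO] at h3
  -- Modulo `N`, every element of `L ∩ N^⊥` is represented in the image of `V`. So the preimage of
  -- `L + N` in `V` is at least as large as `(L ∩ N^⊥ + N)/N`, which gives at least half of `dim V`;
  -- total singularity gives the opposite bound.
  have h4 : L ⊓ O ⊔ N ≤ N ⊔ ((L ⊔ N) ⊓ LinearMap.range g) := by
    refine sup_le ?_ le_sup_left
    intro l hl
    rw [← hM] at hl
    obtain ⟨n, hn, _, ⟨v, rfl⟩, h⟩ := Submodule.mem_sup.mp hl.2
    refine Submodule.mem_sup.mpr ⟨n, hn, g v, ⟨?_, v, rfl⟩, h⟩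
    rw [eq_sub_of_add_eq' h]
    exact sub_mem (Submodule.mem_sup_left hl.1) (Submodule.mem_sup_right hn)
  have h5 := Submodule.finrank_mono h4
  have h6 := Submodule.finrank_sup_add_finrank_inf_eq N ((L ⊔ N) ⊓ LinearMap.range g)
  have h7 : finrank F ↥((L ⊔ N).comap g) = finrank F ↥((L ⊔ N) ⊓ LinearMap.range g) := by
    rw [(Submodule.equivMapOfInjective g hinj _).finrank_eq, Submodule.map_comap_eq, inf_comm]
  have hs : ∀ x ∈ (L ⊔ N).comap g, Q x = 0 := by
    intro v hv
    obtain ⟨l, hl, n, hn, h⟩ := Submodule.mem_sup.mp (Submodule.mem_comap.mp hv)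
    have h8 := hL l hl
    rw [eq_sub_of_add_eq h, sub_eq_add_neg, QuadraticMap.map_add (⇑T), QuadraticMap.map_neg,
      hN n hn, QuadraticMap.polar_neg_right, hgN v n hn, hg] at h8
    simpa using h8
  refine ⟨(L ⊔ N).comap g, hs, ?_⟩
  have h9 := two_mul_finrank_le_of_polar_eq_zero hQ
    (fun x hx y hy => polar_eq_zero_of_totallySingular hs hx hy)
  have := Submodule.finrank_le (L ⊔ N)
  omega

/-- A linearly independent family has a dual family for a nondegenerate bilinear form. -/
theorem exists_dual_family {ι : Type*} [Fintype ι] [DecidableEq ι] {Q : QuadraticForm F V}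
    (hQ : Q.polarBilin.Nondegenerate)
    {x : ι → V} (hx : LinearIndependent F x) :
    ∃ w : ι → V, ∀ i j, QuadraticMap.polar Q (x i) (w j) = if i = j then 1 else 0 := by
  have hinj : Function.Injective (Fintype.linearCombination F x) := by
    rw [injective_iff_map_eq_zero]
    intro c hc
    rw [Fintype.linearIndependent_iff] at hx
    exact funext (hx c hc)
  obtain ⟨l, hl⟩ := LinearMap.exists_leftInverse_of_injective _ (LinearMap.ker_eq_bot.mpr hinj)
  refine ⟨fun j => (LinearMap.BilinForm.toDual Q.polarBilin hQ).symm ((LinearMap.proj j).comp l),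
    fun i j => ?_⟩
  rw [QuadraticMap.polar_comm, ← QuadraticMap.polarBilin_apply_apply,
    LinearMap.BilinForm.apply_toDual_symm_apply]
  have h := LinearMap.congr_fun hl (Pi.single i 1)
  simp only [LinearMap.comp_apply, Fintype.linearCombination_apply_single, one_smul,
    LinearMap.id_apply] at h
  simp [h, Pi.single_apply, eq_comm]

theorem binaryForm_zero_apply (p : F × F) : binaryForm (0 : F) 0 p = p.1 * p.2 := by
  obtain ⟨x, y⟩ := p
  simp [binaryForm_apply]

theorem polar_binaryForm (a b : F) (p p' : F × F) : QuadraticMap.polar (binaryForm a b) p p' =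
    2 * a * p.1 * p'.1 + p.1 * p'.2 + p.2 * p'.1 + 2 * b * p.2 * p'.2 := by
  obtain ⟨x, y⟩ := p
  obtain ⟨x', y'⟩ := p'
  simp only [QuadraticMap.polar, Prod.mk_add_mk, binaryForm_apply]
  ring

theorem hyperbolicForm_apply (k : ℕ) (x : Fin k → F × F) :
    hyperbolicForm F k x = ∑ i, (x i).1 * (x i).2 := by
  simp [hyperbolicForm, QuadraticMap.pi_apply, binaryForm_zero_apply]

theorem nondegenerate_hyperbolicForm (k : ℕ) : (hyperbolicForm F k).polarBilin.Nondegenerate := by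
  classical
  refine nondegenerate_polarBilin fun x hx => funext fun i => ?_
  have key (p : F × F) : (x i).1 * p.2 + (x i).2 * p.1 = 0 := by
    have h := hx (Pi.single i p)
    rw [QuadraticMap.polar, hyperbolicForm_apply, hyperbolicForm_apply, hyperbolicForm_apply,
      ← Finset.sum_sub_distrib, ← Finset.sum_sub_distrib, Finset.sum_eq_single i] at h
    · simp only [Pi.add_apply, Pi.single_eq_same, Prod.fst_add, Prod.snd_add] at h
      linear_combination h
    · intro j _ hj
      simp [hj]
    · simp
  have h1 := key (1, 0)
  have h2 := key (0, 1)
  ext <;> simp_all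

theorem nondegenerate_prod {Q : QuadraticForm F V} (hQ : Q.polarBilin.Nondegenerate)
    {R : QuadraticForm F W} (hR : R.polarBilin.Nondegenerate) :
    (Q.prod R).polarBilin.Nondegenerate := by
  refine nondegenerate_polarBilin fun x hx => ?_
  ext1
  · refine eq_zero_of_polar_eq_zero hQ fun y => ?_
    simpa [QuadraticMap.polar] using hx (y, 0)
  · refine eq_zero_of_polar_eq_zero hR fun y => ?_
    simpa [QuadraticMap.polar] using hx (0, y)

/-- The family `w` dual to a basis of a totally singular space can be corrected to a totally
singular one. -/
theorem exists_totallySingular_dual {ι : Type*} [Fintype ι] [LinearOrder ι]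
    {Q : QuadraticForm F V} {l w : ι → V} (hl : ∀ i j, QuadraticMap.polar Q (l i) (l j) = 0)
    (hl' : ∀ i, Q (l i) = 0)
    (hw : ∀ i j, QuadraticMap.polar Q (l i) (w j) = if i = j then 1 else 0) :
    ∃ c : ι → ι → F, ∀ j, Q (w j + ∑ i, c i j • l i) = 0 ∧
      ∀ i, i ≠ j → QuadraticMap.polar Q (w i + ∑ k, c k i • l k) (w j + ∑ k, c k j • l k) = 0 := by
  -- The correction is triangular because division by two is not available: the diagonal entry
  -- cancels `Q (w j)`, and each polar value is cancelled once, by the entry with `i < j`.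
  let c : ι → ι → F := fun i j =>
    if i = j then -Q (w j) else if i < j then -QuadraticMap.polar Q (w i) (w j) else 0
  have hsum (j : ι) : Q (∑ i, c i j • l i) = 0 :=
    map_sum_eq_zero_of_polar Q _ _ (fun i => by simp [QuadraticMap.map_smul, hl'])
      fun i k _ => by simp [hl]
  have hB (x : V) (j : ι) : QuadraticMap.polar Q x (∑ i, c i j • l i) =
      ∑ i, c i j * QuadraticMap.polar Q x (l i) := by
    rw [← QuadraticMap.polarBilin_apply_apply, map_sum]
    simp
  have hwl (i j : ι) : QuadraticMap.polar Q (w i) (l j) = if j = i then 1 else 0 := by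
    rw [QuadraticMap.polar_comm, hw]
  have hwc (i j : ι) : QuadraticMap.polar Q (w i) (∑ k, c k j • l k) = c i j := by
    rw [hB]; simp [hwl]
  have hcc (i j : ι) : QuadraticMap.polar Q (∑ k, c k i • l k) (∑ k, c k j • l k) = 0 := by
    rw [hB]
    refine Finset.sum_eq_zero fun k _ => ?_
    rw [QuadraticMap.polar_comm, hB]
    simp [hl]
  refine ⟨c, fun j => ⟨?_, fun i hij => ?_⟩⟩
  · rw [QuadraticMap.map_add (⇑Q), hsum, hwc]
    simp [c]
  · rw [QuadraticMap.polar_add_left, QuadraticMap.polar_add_right, QuadraticMap.polar_add_right,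
      hwc, hcc, QuadraticMap.polar_comm Q (∑ k, c k i • l k) (w j), hwc]
    rcases lt_or_gt_of_ne hij with h | h
    · simp [c, hij, hij.symm, h, h.not_gt]
    · simp [c, hij, hij.symm, h, h.not_gt, QuadraticMap.polar_comm Q (w i) (w j)]

/-- A nondegenerate quadratic space is the orthogonal sum of a nondegenerate subspace and a
hyperbolic space if the orthogonal complement of the subspace has a Lagrangian. -/
theorem equivalent_prod_hyperbolicForm {R : QuadraticForm F V}
    (hR : R.polarBilin.Nondegenerate) {T : QuadraticForm F W} (hT : T.polarBilin.Nondegenerate)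
    (f : V →ₗ[F] W) (hf : ∀ v, T (f v) = R v) {L : Submodule F W} (hL : ∀ x ∈ L, T x = 0)
    (hfL : ∀ v, ∀ x ∈ L, QuadraticMap.polar T (f v) x = 0) {k : ℕ} (hk : finrank F L = k)
    (hdim : finrank F W = finrank F V + 2 * k) :
    T.Equivalent (R.prod (hyperbolicForm F k)) := by
  have hinj := injective_of_isometric hR f hf
  let b : Basis (Fin k) F L := finBasisOfFinrankEq F L hk
  let l : Fin k → W := fun i => b i
  let e := finBasis F V
  have hlL (i : Fin k) : l i ∈ L := (b i).2
  -- The image of a basis of `V` is included in the family so that the vectors dual to `l` are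
  -- automatically orthogonal to `f V`.
  have hli : LinearIndependent F (Sum.elim (f ∘ e) l) := by
    refine LinearIndependent.sum_type (e.linearIndependent.map' f (LinearMap.ker_eq_bot.mpr hinj))
      (b.linearIndependent.map' L.subtype (LinearMap.ker_eq_bot.mpr L.injective_subtype)) ?_
    rw [Submodule.disjoint_def]
    intro x hx hx'
    have hxL : x ∈ L := by
      refine Submodule.span_le.mpr ?_ hx'
      rintro _ ⟨i, rfl⟩
      exact hlL i
    have hxf : x ∈ LinearMap.range f := by
      refine Submodule.span_le.mpr ?_ hx
      rintro _ ⟨i, rfl⟩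
      exact ⟨e i, rfl⟩
    obtain ⟨v, rfl⟩ := hxf
    rw [eq_zero_of_polar_eq_zero hR (x := v), map_zero]
    intro y
    rw [← polar_isometric f hf, QuadraticMap.polar_comm]
    exact hfL y _ hxL
  obtain ⟨w', hw'⟩ := exists_dual_family hT hli
  have hll (i j : Fin k) : QuadraticMap.polar T (l i) (l j) = 0 :=
    polar_eq_zero_of_totallySingular hL (hlL i) (hlL j)
  have hlw' (i j : Fin k) :
      QuadraticMap.polar T (l i) (w' (Sum.inr j)) = if i = j then 1 else 0 := by
    simpa using hw' (Sum.inr i) (Sum.inr j)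
  obtain ⟨c, hc⟩ := exists_totallySingular_dual hll (fun i => hL _ (hlL i)) hlw'
  set w : Fin k → W := fun j => w' (Sum.inr j) + ∑ i, c i j • l i with hw_def
  have hsumL (j : Fin k) : ∑ i, c i j • l i ∈ L := sum_mem fun i _ => L.smul_mem _ (hlL i)
  have hlw (i j : Fin k) : QuadraticMap.polar T (l i) (w j) = if i = j then 1 else 0 := by
    rw [hw_def, QuadraticMap.polar_add_right, hlw',
      polar_eq_zero_of_totallySingular hL (hlL i) (hsumL j), add_zero]
  have hfw (v : V) (j : Fin k) : QuadraticMap.polar T (f v) (w j) = 0 := by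
    rw [hw_def, QuadraticMap.polar_add_right, hfL v _ (hsumL j), add_zero]
    have : (T.polarBilin.flip (w' (Sum.inr j))) ∘ₗ f = 0 := by
      refine e.ext fun i => ?_
      simpa using hw' (Sum.inl i) (Sum.inr j)
    simpa using LinearMap.congr_fun this v
  let Ψ : V × (Fin k → F × F) →ₗ[F] W := LinearMap.coprod f
    (∑ i, ((LinearMap.fst F F F ∘ₗ LinearMap.proj i).smulRight (l i) +
      (LinearMap.snd F F F ∘ₗ LinearMap.proj i).smulRight (w i)))
  have hΨ (v : V) (p : Fin k → F × F) :
      Ψ (v, p) = f v + (∑ i, (p i).1 • l i + ∑ i, (p i).2 • w i) := by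
    simp [Ψ, Finset.sum_add_distrib]
  have hiso (x : V × (Fin k → F × F)) : T (Ψ x) = R.prod (hyperbolicForm F k) x := by
    obtain ⟨v, p⟩ := x
    have h1 : T (∑ i, (p i).1 • l i) = 0 := hL _ (sum_mem fun i _ => L.smul_mem _ (hlL i))
    have h2 : T (∑ i, (p i).2 • w i) = 0 := map_sum_eq_zero_of_polar T _ _
      (fun i => by rw [QuadraticMap.map_smul, (hc i).1, smul_zero])
      fun i j hij => by
        rw [QuadraticMap.polar_smul_left, QuadraticMap.polar_smul_right, (hc j).2 i hij]; simp
    have h3 : QuadraticMap.polar T (∑ i, (p i).1 • l i) (∑ i, (p i).2 • w i) =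
        ∑ i, (p i).1 * (p i).2 := by
      rw [← QuadraticMap.polarBilin_apply_apply, map_sum]
      refine Finset.sum_congr rfl fun j _ => ?_
      rw [QuadraticMap.polarBilin_apply_apply, QuadraticMap.polar_comm,
        ← QuadraticMap.polarBilin_apply_apply, map_sum, Finset.sum_eq_single j]
      · simp [QuadraticMap.polar_comm T (w j), hlw]
      · intro i _ hij
        simp [QuadraticMap.polar_comm T (w j), hlw, hij]
      · simp
    have h4 : QuadraticMap.polar T (f v) (∑ i, (p i).1 • l i + ∑ i, (p i).2 • w i) = 0 := by
      rw [QuadraticMap.polar_add_right, hfL v _ (sum_mem fun i _ => L.smul_mem _ (hlL i)),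
        ← QuadraticMap.polarBilin_apply_apply, map_sum]
      simp [hfw]
    rw [hΨ, QuadraticMap.map_add (⇑T), h4, QuadraticMap.map_add (⇑T), h1, h2, h3, hf,
      QuadraticMap.prod_apply, hyperbolicForm_apply]
    simp
  have hΨinj := injective_of_isometric (nondegenerate_prod hR (nondegenerate_hyperbolicForm k))
    Ψ hiso
  have hfin : finrank F (V × (Fin k → F × F)) = finrank F W := by
    rw [hdim, finrank_prod, finrank_pi_fintype]; simp [mul_comm]
  let Ψ' := LinearEquiv.ofInjectiveOfFinrankEq Ψ hΨinj hfin
  exact QuadraticMap.Equivalent.symm ⟨⟨Ψ', fun x => hiso x⟩⟩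

end Lagrangian

/-! ### Recognising hyperbolic spaces and cancelling a binary form -/

section Hyperbolic

open Module

set_option linter.unusedSectionVars false

theorem hyperbolicForm_add_equivalent {F : Type*} [Field F] (a b : ℕ) :
    (hyperbolicForm F (a + b)).Equivalent ((hyperbolicForm F a).prod (hyperbolicForm F b)) := by
  refine ⟨⟨(LinearEquiv.funCongrLeft F (F × F) finSumFinEquiv).trans
    (LinearEquiv.sumArrowLequivProdArrow _ _ F (F × F)), fun x => ?_⟩⟩
  simp [QuadraticMap.prod_apply, hyperbolicForm_apply, Fin.sum_univ_add, LinearEquiv.funCongrLeft,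
    LinearMap.funLeft]

theorem equivalent_prod_congr {F V V' W W' : Type*} [Field F] [AddCommGroup V] [Module F V]
    [AddCommGroup V'] [Module F V'] [AddCommGroup W] [Module F W] [AddCommGroup W'] [Module F W']
    {Q : QuadraticForm F V} {Q' : QuadraticForm F V'} {R : QuadraticForm F W}
    {R' : QuadraticForm F W'} (h : Q.Equivalent Q') (h' : R.Equivalent R') :
    (Q.prod R).Equivalent (Q'.prod R') := by
  obtain ⟨e⟩ := h
  obtain ⟨e'⟩ := h'
  exact ⟨QuadraticMap.IsometryEquiv.prod e e'⟩

theorem prod_hyperbolicForm_zero_equivalent {F V : Type*} [Field F] [AddCommGroup V] [Module F V]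
    (Q : QuadraticForm F V) : (Q.prod (hyperbolicForm F 0)).Equivalent Q := by
  refine ⟨⟨LinearEquiv.prodUnique, fun x => ?_⟩⟩
  simp [QuadraticMap.prod_apply, hyperbolicForm_apply]

theorem hyperbolicForm_zero_prod_equivalent {F : Type*} [Field F] (m : ℕ) :
    ((hyperbolicForm F 0).prod (hyperbolicForm F m)).Equivalent (hyperbolicForm F m) := by
  refine ⟨⟨LinearEquiv.uniqueProd, fun x => ?_⟩⟩
  simp [QuadraticMap.prod_apply, hyperbolicForm_apply]

theorem totallySingular_span_singleton {F V : Type*} [Field F] [AddCommGroup V] [Module F V]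
    {Q : QuadraticForm F V} {y : V} (hy : Q y = 0) : ∀ x ∈ Submodule.span F {y}, Q x = 0 := by
  intro x hx
  obtain ⟨c, rfl⟩ := Submodule.mem_span_singleton.mp hx
  rw [QuadraticMap.map_smul, hy, smul_zero]

theorem wittEquivalent_of_equivalent_prod {F V W : Type*} [Field F] [AddCommGroup V] [Module F V]
    [AddCommGroup W] [Module F W] {Q : QuadraticForm F V} {R : QuadraticForm F W} {k : ℕ}
    (h : Q.Equivalent (R.prod (hyperbolicForm F k))) : WittEquivalent Q R :=
  ⟨0, k, (prod_hyperbolicForm_zero_equivalent Q).trans h⟩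

variable {F V : Type*} [Field F] [AddCommGroup V] [Module F V] [FiniteDimensional F V]

/-- A nondegenerate quadratic space with a Lagrangian is hyperbolic. -/
theorem equivalent_hyperbolicForm_of_lagrangian {Q : QuadraticForm F V}
    (hQ : Q.polarBilin.Nondegenerate) {L : Submodule F V} (hL : ∀ x ∈ L, Q x = 0) {m : ℕ}
    (hm : finrank F L = m) (hdim : finrank F V = 2 * m) :
    Q.Equivalent (hyperbolicForm F m) := by
  refine (equivalent_prod_hyperbolicForm (nondegenerate_hyperbolicForm 0) hQ 0 (fun v => ?_) hL
    (fun v x _ => ?_) hm ?_).trans (hyperbolicForm_zero_prod_equivalent m)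
  · simp [hyperbolicForm_apply]
  · simp
  · rw [hdim, finrank_zero_of_subsingleton (M := Fin 0 → F × F), zero_add]

variable [CharP F 2]

theorem polar_binaryForm_of_charTwo (a b : F) (p p' : F × F) :
    QuadraticMap.polar (binaryForm a b) p p' = p.1 * p'.2 + p.2 * p'.1 := by
  rw [polar_binaryForm]
  linear_combination (a * p.1 * p'.1 + b * p.2 * p'.2) * (CharTwo.two_eq_zero (R := F))

theorem nondegenerate_binaryForm (a b : F) : (binaryForm a b).polarBilin.Nondegenerate := by
  refine nondegenerate_polarBilin fun x hx => ?_
  have h1 := hx (1, 0)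
  have h2 := hx (0, 1)
  rw [polar_binaryForm_of_charTwo] at h1 h2
  ext <;> simp_all

/-- If `β` is an anisotropic plane and `Q ⊥ β` has a Lagrangian, then `Q` is the sum of `β` and
a hyperbolic space. -/
theorem equivalent_binaryForm_prod_of_anisotropic {Q : QuadraticForm F V}
    (hQ : Q.polarBilin.Nondegenerate) {m : ℕ} (hdim : finrank F V = 2 * m) {a b : F}
    (hβ : ∀ p, binaryForm a b p = 0 → p = 0) {L : Submodule F (V × F × F)}
    (hL : ∀ x ∈ L, Q.prod (binaryForm a b) x = 0) (hdimL : finrank F L = m + 1) :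
    Q.Equivalent ((binaryForm a b).prod (hyperbolicForm F (m - 1))) := by
  have hpol (x y : V × F × F) (hx : x ∈ L) (hy : y ∈ L) :
      QuadraticMap.polar Q x.1 y.1 + QuadraticMap.polar (binaryForm a b) x.2 y.2 = 0 := by
    have h := polar_eq_zero_of_totallySingular hL hx hy
    simp only [QuadraticMap.polar, QuadraticMap.prod_apply, Prod.fst_add, Prod.snd_add] at h ⊢
    linear_combination h
  let π : L →ₗ[F] F × F := (LinearMap.snd F V (F × F)).domRestrict L
  have hrank := LinearMap.finrank_range_add_finrank_ker π
  have hsurj : LinearMap.range π = ⊤ := by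
    -- Otherwise the projection of `L` to the plane lies in a line, where the alternating polar form
    -- vanishes. Then `L`, which embeds in `V` because the plane is anisotropic, has as image an
    -- `(m+1)`-dimensional space with zero polar form inside dimension `2m`.
    by_contra hne
    have h1 := Submodule.finrank_lt hne
    rw [finrank_prod, finrank_self] at h1
    have h2 : finrank F (LinearMap.range π) ≤ 1 := by omega
    obtain ⟨p, hp⟩ := finrank_le_one_iff.mp h2
    have hinj : Function.Injective ((LinearMap.fst F V (F × F)).domRestrict L) := by
      rw [injective_iff_map_eq_zero]
      rintro ⟨⟨v, q⟩, hx⟩ h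
      obtain rfl : v = 0 := h
      have h3 := hL _ hx
      simp only [QuadraticMap.prod_apply, map_zero, zero_add] at h3
      simp [hβ _ h3]
    have h4 := LinearMap.finrank_range_of_inj hinj
    have h5 := two_mul_finrank_le_of_polar_eq_zero hQ
      (L := LinearMap.range ((LinearMap.fst F V (F × F)).domRestrict L)) (by
        rintro _ ⟨⟨x, hx⟩, rfl⟩ _ ⟨⟨y, hy⟩, rfl⟩
        have h6 := hpol x y hx hy
        obtain ⟨c, hc⟩ := hp ⟨x.2, ⟨x, hx⟩, rfl⟩
        obtain ⟨d, hd⟩ := hp ⟨y.2, ⟨y, hy⟩, rfl⟩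
        replace hc := congrArg Subtype.val hc
        replace hd := congrArg Subtype.val hd
        simp only [Submodule.coe_smul] at hc hd
        rw [← hc, ← hd, polar_binaryForm_of_charTwo] at h6
        simp only [LinearMap.domRestrict_apply, LinearMap.fst_apply]
        simp only [Prod.smul_fst, Prod.smul_snd, smul_eq_mul] at h6
        linear_combination h6 - c * d * p.1.1 * p.1.2 * (CharTwo.two_eq_zero (R := F)))
    omega
  rw [hsurj, finrank_top, finrank_prod, finrank_self] at hrank
  have hex (p : F × F) : ∃ v, (v, p) ∈ L := by
    obtain ⟨⟨⟨v, q⟩, hx⟩, h⟩ : p ∈ LinearMap.range π := hsurj ▸ Submodule.mem_top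
    obtain rfl : q = p := h
    exact ⟨v, hx⟩
  obtain ⟨v₁, h₁⟩ := hex (1, 0)
  obtain ⟨v₂, h₂⟩ := hex (0, 1)
  -- A section of the projection with graph inside `L`. Total singularity of the graph makes `Q (f
  -- p)` the negative of the binary form at `p`, hence equal to it in characteristic two, and `L ∩
  -- V` is a Lagrangian of the complement of the image.
  let f : F × F →ₗ[F] V := LinearMap.coprod (LinearMap.toSpanSingleton F V v₁)
    (LinearMap.toSpanSingleton F V v₂)
  have hf (p : F × F) : (f p, p) ∈ L := by
    have h := L.add_mem (L.smul_mem p.1 h₁) (L.smul_mem p.2 h₂)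
    simpa [f] using h
  let U : Submodule F V := L.comap (LinearMap.inl F V (F × F))
  have hU (x : V) (hx : x ∈ U) : (x, (0 : F × F)) ∈ L := hx
  have hUfin : finrank F U = finrank F (LinearMap.ker π) := by
    have hker : (LinearMap.ker π).map L.subtype = U.map (LinearMap.inl F V (F × F)) := by
      ext ⟨v, q⟩
      constructor
      · rintro ⟨⟨⟨v', q'⟩, hx⟩, hx', h⟩
        obtain rfl : q' = 0 := hx'
        obtain ⟨rfl, rfl⟩ := Prod.mk.inj h
        exact ⟨v', hx, rfl⟩
      · rintro ⟨v', hx, h⟩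
        obtain ⟨rfl, rfl⟩ := Prod.mk.inj h
        exact ⟨⟨(v', 0), hx⟩, rfl, rfl⟩
    rw [(Submodule.equivMapOfInjective L.subtype L.injective_subtype _).finrank_eq, hker,
      (Submodule.equivMapOfInjective (LinearMap.inl F V (F × F)) LinearMap.inl_injective
        U).finrank_eq]
  refine equivalent_prod_hyperbolicForm (nondegenerate_binaryForm a b) hQ f (fun p => ?_)
    (L := U) (fun x hx => ?_) (fun p x hx => ?_) (k := m - 1) (by omega) ?_
  · have h := hL _ (hf p)
    rw [QuadraticMap.prod_apply] at h
    exact CharTwo.add_eq_zero.mp h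
  · simpa [QuadraticMap.prod_apply] using hL _ (hU x hx)
  · simpa [QuadraticMap.polar] using hpol _ _ (hf p) (hU x hx)
  · rw [finrank_prod, finrank_self]
    omega

/-- If the plane is isotropic it is itself hyperbolic, and reducing modulo its singular line moves
the Lagrangian to `Q`, which is then hyperbolic too. Otherwise the anisotropic case applies. -/
theorem equivalent_binaryForm_prod_of_lagrangian {Q : QuadraticForm F V}
    (hQ : Q.polarBilin.Nondegenerate) {m : ℕ} (hm : 1 ≤ m) (hdim : finrank F V = 2 * m) {a b : F}
    {L : Submodule F (V × F × F)}
    (hL : ∀ x ∈ L, Q.prod (binaryForm a b) x = 0) (hdimL : finrank F L = m + 1) :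
    Q.Equivalent ((binaryForm a b).prod (hyperbolicForm F (m - 1))) := by
  by_cases hβ : ∀ p, binaryForm a b p = 0 → p = 0
  · exact equivalent_binaryForm_prod_of_anisotropic hQ hdim hβ hL hdimL
  push Not at hβ
  obtain ⟨p, hp, hp0⟩ := hβ
  have h1 : (binaryForm a b).Equivalent (hyperbolicForm F 1) :=
    equivalent_hyperbolicForm_of_lagrangian (nondegenerate_binaryForm a b)
      (totallySingular_span_singleton hp) (finrank_span_singleton hp0) (by simp)
  have hp0' : ((0 : V), p) ≠ 0 := fun h => hp0 (congrArg Prod.snd h)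
  obtain ⟨L', hL', hdimL'⟩ := exists_lagrangian_of_reduction hQ
    (nondegenerate_prod hQ (nondegenerate_binaryForm a b)) (LinearMap.inl F V (F × F))
    (fun v => by simp [QuadraticMap.prod_apply]) (N := Submodule.span F {(0, p)})
    (totallySingular_span_singleton (by simp [QuadraticMap.prod_apply, hp]))
    (fun v x hx => by
      obtain ⟨c, rfl⟩ := Submodule.mem_span_singleton.mp hx
      simp [QuadraticMap.polar, QuadraticMap.prod_apply])
    (by rw [finrank_span_singleton hp0', finrank_prod, finrank_prod, finrank_self]) hL
    (by rw [finrank_prod, finrank_prod, finrank_self]; omega)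
  obtain ⟨k, rfl⟩ : ∃ k, m = 1 + k := ⟨m - 1, by omega⟩
  rw [Nat.add_sub_cancel_left]
  exact (equivalent_hyperbolicForm_of_lagrangian hQ hL' (by omega) hdim).trans
    ((hyperbolicForm_add_equivalent 1 k).trans
      (equivalent_prod_congr h1.symm (QuadraticMap.Equivalent.refl _)))

end Hyperbolic

/-! ### Descent of Lagrangians along odd degree extensions -/

section OddExtension

open Module

set_option linter.unusedSectionVars false

variable {F E : Type*} [Field F] [Field E] [Algebra F E]

theorem powerBasis_coord_zero_pow (pb : PowerBasis F E) (h : 0 < pb.dim) {i : ℕ}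
    (hi : i < pb.dim) : pb.basis.coord ⟨0, h⟩ (pb.gen ^ i) = if i = 0 then 1 else 0 := by
  have h1 : pb.gen ^ i = pb.basis ⟨i, hi⟩ := by simp
  rw [h1, Basis.coord_apply, Basis.repr_self, Finsupp.single_apply]
  simp [Fin.ext_iff]

/-- If a nondegenerate quadratic space gets a Lagrangian over an extension of odd degree, it has
one. -/
theorem exists_lagrangian_of_odd_extension {V VE : Type*} [AddCommGroup V] [Module F V]
    [FiniteDimensional F V] [AddCommGroup VE] [Module E VE] [Module F VE] [IsScalarTower F E VE]
    [FiniteDimensional E VE] {Q : QuadraticForm F V} (hQ : Q.polarBilin.Nondegenerate)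
    {QE : QuadraticForm E VE} (hQE : QE.polarBilin.Nondegenerate) (pb : PowerBasis F E) {m : ℕ}
    (hm : pb.dim = 2 * m + 1) (j : V →ₗ[F] VE) (hj : ∀ v, QE (j v) = algebraMap F E (Q v))
    (hinj : ∀ v : Fin pb.dim → V, ∑ i : Fin pb.dim, pb.gen ^ (i : ℕ) • j (v i) = 0 → v = 0)
    (hfin : finrank E VE = finrank F V) {L : Submodule E VE} (hL : ∀ x ∈ L, QE x = 0)
    (hdimL : 2 * finrank E L = finrank E VE) :
    ∃ L' : Submodule F V, (∀ x ∈ L', Q x = 0) ∧ 2 * finrank F L' = finrank F V := by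
  have : FiniteDimensional F E := pb.finite
  have : FiniteDimensional F VE := Module.Finite.trans E VE
  have hpos : 0 < pb.dim := by omega
  let s : E →ₗ[F] F := pb.basis.coord ⟨0, hpos⟩
  have hs1 : s 1 = 1 := by
    simpa only [pow_zero, if_true] using powerBasis_coord_zero_pow pb hpos hpos
  have hs {i : ℕ} (h0 : i ≠ 0) (hi : i < pb.dim) : s (pb.gen ^ i) = 0 := by
    simpa only [h0, if_false] using powerBasis_coord_zero_pow pb hpos hi
  let T : QuadraticForm F VE := s.compQuadraticMap (QE.restrictScalars (S := F))
  have hT (x : VE) : T x = s (QE x) := rfl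
  have hTp (x y : VE) : QuadraticMap.polar T x y = s (QuadraticMap.polar QE x y) := by
    simp [QuadraticMap.polar, hT]
  have hjp (v w : V) : QuadraticMap.polar QE (j v) (j w) =
      algebraMap F E (QuadraticMap.polar Q v w) := by
    simp only [QuadraticMap.polar, ← map_add, hj, map_sub]
  have hsmul (x : E) (c : F) : s (x * algebraMap F E c) = c * s x := by
    rw [mul_comm, ← Algebra.smul_def, map_smul, smul_eq_mul]
  -- A nonzero polar value over `E` can be rescaled to `1`, where `s` does not vanish.
  have hTn : T.polarBilin.Nondegenerate := by
    refine nondegenerate_polarBilin fun x hx => eq_zero_of_polar_eq_zero hQE fun y => ?_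
    by_contra hne
    have h := hx ((QuadraticMap.polar QE x y)⁻¹ • y)
    rw [hTp, QuadraticMap.polar_smul_right, smul_eq_mul, inv_mul_cancel₀ hne, hs1] at h
    exact one_ne_zero h
  -- The image is `αV + ⋯ + α^m V`. Products of two summands carry exponents `2, …, 2m`, and
  -- products with `V` itself exponents `1, …, m`; all are positive and below the degree `2m + 1`,
  -- so `s` kills them.
  let Ψ : (Fin m → V) →ₗ[F] VE :=
    { toFun v := ∑ i : Fin m, pb.gen ^ (i + 1 : ℕ) • j (v i)
      map_add' v w := by simp [Finset.sum_add_distrib]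
      map_smul' c v := by simp [Finset.smul_sum, smul_comm c] }
  have hΨ (v : Fin m → V) : Ψ v = ∑ i : Fin m, pb.gen ^ (i + 1 : ℕ) • j (v i) := rfl
  have hΨinj : Function.Injective Ψ := by
    rw [injective_iff_map_eq_zero]
    intro v hv
    let ε : Fin m → Fin pb.dim := fun i => ⟨i + 1, by omega⟩
    have hε : Function.Injective ε := fun i k h => by
      simpa [ε, Fin.ext_iff] using h
    have h := hinj (Function.extend ε v 0) (by
      rw [← hv, hΨ]
      symm
      refine Fintype.sum_of_injective ε hε _ _ (fun i hi => ?_) (fun i => ?_)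
      · rw [Function.extend_apply' _ _ _ hi]; simp
      · rw [hε.extend_apply])
    funext i
    rw [← hε.extend_apply v 0 i, h]
    rfl
  have hpolΨ (v : V) (w : Fin m → V) {i : ℕ} (hi : i ≤ m) :
      QuadraticMap.polar T (pb.gen ^ i • j v) (Ψ w) = 0 := by
    rw [hΨ, ← QuadraticMap.polarBilin_apply_apply, map_sum]
    refine Finset.sum_eq_zero fun k _ => ?_
    rw [QuadraticMap.polarBilin_apply_apply, hTp, QuadraticMap.polar_smul_left,
      QuadraticMap.polar_smul_right, hjp, smul_eq_mul, smul_eq_mul, ← mul_assoc, ← pow_add, hsmul,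
      hs (by omega) (by omega), mul_zero]
  obtain ⟨L', hL', hdimL'⟩ := exists_lagrangian_of_reduction hQ hTn j
    (fun v => by
      rw [hT, hj, ← one_mul (algebraMap F E (Q v)), hsmul, hs1, mul_one])
    (N := LinearMap.range Ψ) (by
      rintro _ ⟨v, rfl⟩
      rw [hΨ]
      refine map_sum_eq_zero_of_polar T _ _ (fun i => ?_) fun i k _ => ?_
      · rw [hT, QuadraticMap.map_smul, hj, smul_eq_mul, ← pow_add, hsmul, hs (by omega) (by omega),
          mul_zero]
      · rw [hTp, QuadraticMap.polar_smul_left,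
          QuadraticMap.polar_smul_right, hjp, smul_eq_mul, smul_eq_mul, ← mul_assoc, ← pow_add,
          hsmul, hs (by omega) (by omega), mul_zero])
    (by
      rintro v _ ⟨w, rfl⟩
      simpa using hpolΨ v w (Nat.zero_le m))
    (by
      rw [LinearMap.finrank_range_of_inj hΨinj, ← finrank_mul_finrank F E VE, pb.finrank, hm, hfin,
        finrank_pi_fintype]
      simp
      ring)
    (L := L.restrictScalars F) (fun x hx => by rw [hT, hL x hx, map_zero])
    (by
      have h : finrank F (L.restrictScalars F) = finrank F E * finrank E L :=
        (finrank_mul_finrank F E L).symm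
      rw [h, ← finrank_mul_finrank F E VE, ← hdimL]
      ring)
  exact ⟨L', hL', hdimL'⟩

end OddExtension

/-! ### Sums of principal 2 × 2 minors and the second elementary symmetric function -/

section MinorSum

open Finset

variable {ι R : Type*} [DecidableEq ι] [CommRing R]

/-- The sum of the `2 × 2` principal minors with indices in `t`. -/
noncomputable def minorSum (t : Finset ι) (M : Matrix ι ι R) : R :=
  ∑ s ∈ t.powersetCard 2, (M.submatrix (Subtype.val : s → ι) (Subtype.val : s → ι)).det

theorem minorSum_empty (M : Matrix ι ι R) : minorSum ∅ M = 0 := by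
  rw [minorSum, powersetCard_eq_empty.mpr (by simp), sum_empty]

theorem det_submatrix_pair (M : Matrix ι ι R) {a b : ι} (h : a ≠ b) :
    (M.submatrix (Subtype.val : ({a, b} : Finset ι) → ι) Subtype.val).det =
      M a a * M b b - M a b * M b a := by
  let f : Fin 2 → ({a, b} : Finset ι) := ![⟨a, by simp⟩, ⟨b, by simp⟩]
  have hf : Function.Bijective f := by
    rw [Fintype.bijective_iff_injective_and_card]
    refine ⟨fun i j hij => ?_, by simp [card_pair h]⟩
    fin_cases i <;> fin_cases j <;> simp_all [f]
  rw [← Matrix.det_submatrix_equiv_self (Equiv.ofBijective f hf), Matrix.det_fin_two]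
  simp [f]

theorem minorSum_insert {a : ι} {t : Finset ι} (ha : a ∉ t) (M : Matrix ι ι R) :
    minorSum (insert a t) M = minorSum t M + ∑ j ∈ t, (M a a * M j j - M a j * M j a) := by
  have hdisj : Disjoint (t.powersetCard 2) ((t.powersetCard 1).image (insert a)) := by
    rw [Finset.disjoint_left]
    intro s hs hs'
    obtain ⟨s', _, rfl⟩ := mem_image.mp hs'
    exact ha ((mem_powersetCard.mp hs).1 (mem_insert_self a s'))
  rw [minorSum, powersetCard_succ_insert ha, sum_union hdisj, sum_image, powersetCard_one, sum_map]
  · congr 1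
    refine sum_congr rfl fun j hj => ?_
    exact det_submatrix_pair M fun h => ha (h ▸ hj)
  · intro s hs s' hs' h
    rw [← erase_insert fun h' => ha ((mem_powersetCard.mp hs).1 h'),
      ← erase_insert fun h' => ha ((mem_powersetCard.mp hs').1 h')]
    exact congrArg (fun s => s.erase a) h

/-- On the full index set this says that the polar form of the sum of minors is `tr M tr N - tr
(MN)`, the source of every polar form computation for `t_2`. -/
theorem minorSum_add (t : Finset ι) (M N : Matrix ι ι R) :
    minorSum t (M + N) = minorSum t M + minorSum t N +
      ((∑ i ∈ t, M i i) * (∑ i ∈ t, N i i) - ∑ i ∈ t, ∑ j ∈ t, M i j * N j i) := by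
  induction t using Finset.induction_on with
  | empty => simp [minorSum_empty]
  | insert a t ha ih =>
    simp only [minorSum_insert ha, sum_insert ha, ih, Matrix.add_apply, sum_add_distrib,
      sum_sub_distrib, ← mul_sum, mul_add, add_mul]
    have h : ∑ j ∈ t, N a j * M j a = ∑ j ∈ t, M j a * N a j :=
      sum_congr rfl fun _ _ => mul_comm _ _
    linear_combination -h

theorem minorSum_smul (t : Finset ι) (c : R) (M : Matrix ι ι R) :
    minorSum t (c • M) = c * c * minorSum t M := by
  induction t using Finset.induction_on with
  | empty => simp [minorSum_empty]
  | insert a t ha ih =>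
    rw [minorSum_insert ha, minorSum_insert ha, ih, mul_add, mul_sum]
    congr 1
    refine sum_congr rfl fun j _ => ?_
    simp only [Matrix.smul_apply, smul_eq_mul]
    ring

theorem minorSum_map {S : Type*} [CommRing S] (f : R →+* S) (t : Finset ι) (M : Matrix ι ι R) :
    minorSum t (M.map f) = f (minorSum t M) := by
  induction t using Finset.induction_on with
  | empty => simp [minorSum_empty]
  | insert a t ha ih => simp [minorSum_insert ha, ih]

theorem charpoly_coeff_eq_minorSum [Fintype ι] (M : Matrix ι ι R) (h : 2 ≤ Fintype.card ι) :
    M.charpoly.coeff (Fintype.card ι - 2) = minorSum univ M := by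
  rw [Matrix.charpoly_coeff_eq_sum_minors M 2 h]
  simp [minorSum]

theorem minorSum_eq_zero_of_card_lt [Fintype ι] (M : Matrix ι ι R) (h : Fintype.card ι < 2) :
    minorSum univ M = 0 := by
  rw [minorSum, powersetCard_eq_empty.mpr (by simpa using h), sum_empty]

/-- The second elementary symmetric function of the `x i` with `i ∈ t`. -/
noncomputable def secondSymm (t : Finset ι) (x : ι → R) : R := minorSum t (Matrix.diagonal x)

theorem secondSymm_empty (x : ι → R) : secondSymm ∅ x = 0 := minorSum_empty _

theorem secondSymm_singleton (a : ι) (x : ι → R) : secondSymm {a} x = 0 := by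
  rw [secondSymm, minorSum, powersetCard_eq_empty.mpr (by simp), sum_empty]

theorem secondSymm_insert {a : ι} {t : Finset ι} (ha : a ∉ t) (x : ι → R) :
    secondSymm (insert a t) x = secondSymm t x + x a * ∑ j ∈ t, x j := by
  rw [secondSymm, minorSum_insert ha, secondSymm, mul_sum]
  congr 1
  refine sum_congr rfl fun j hj => ?_
  have : a ≠ j := fun h => ha (h ▸ hj)
  simp [this]

theorem minorSum_eq_secondSymm (t : Finset ι) (M : Matrix ι ι R)
    (h : ∀ i j, i ≠ j → M i j * M j i = 0) : minorSum t M = secondSymm t fun i => M i i := by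
  induction t using Finset.induction_on with
  | empty => simp [minorSum_empty, secondSymm_empty]
  | insert a t ha ih =>
    rw [minorSum_insert ha, secondSymm_insert ha, ih, mul_sum]
    congr 1
    refine sum_congr rfl fun j hj => ?_
    rw [h a j fun h => ha (h ▸ hj), sub_zero]

theorem secondSymm_add (t : Finset ι) (x y : ι → R) :
    secondSymm t (x + y) = secondSymm t x + secondSymm t y +
      ((∑ i ∈ t, x i) * (∑ i ∈ t, y i) - ∑ i ∈ t, x i * y i) := by
  induction t using Finset.induction_on with
  | empty => simp [secondSymm_empty]
  | insert a t ha ih =>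
    simp only [secondSymm_insert ha, sum_insert ha, ih, Pi.add_apply, sum_add_distrib]
    ring

theorem secondSymm_smul (t : Finset ι) (c : R) (x : ι → R) :
    secondSymm t (c • x) = c * c * secondSymm t x := by
  rw [secondSymm, Matrix.diagonal_smul, minorSum_smul, secondSymm]

theorem map_secondSymm {S : Type*} [CommRing S] (f : R →+* S) (t : Finset ι) (x : ι → R) :
    f (secondSymm t x) = secondSymm t (f ∘ x) := by
  rw [secondSymm, ← minorSum_map, Matrix.diagonal_map (map_zero f), secondSymm]
  rfl

theorem secondSymm_map {κ : Type*} [DecidableEq κ] (f : κ ↪ ι) (t : Finset κ) (x : ι → R) :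
    secondSymm (t.map f) x = secondSymm t (x ∘ f) := by
  induction t using Finset.induction_on with
  | empty => simp [secondSymm_empty]
  | insert a t ha ih =>
    rw [map_insert, secondSymm_insert (by simpa using ha), secondSymm_insert ha, ih]
    simp

theorem secondSymm_disjUnion (s t : Finset ι) (h : Disjoint s t) (x : ι → R) :
    secondSymm (s ∪ t) x =
      secondSymm s x + secondSymm t x + (∑ i ∈ s, x i) * ∑ i ∈ t, x i := by
  induction s using Finset.induction_on with
  | empty => simp [secondSymm_empty]
  | insert a s ha ih =>
    rw [disjoint_insert_left] at h
    rw [insert_union, secondSymm_insert (by simp [ha, h.1]), ih h.2, secondSymm_insert ha,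
      sum_union h.2, sum_insert ha]
    ring

theorem secondSymm_comp_equiv {κ : Type*} [DecidableEq κ] [Fintype ι] [Fintype κ] (e : κ ≃ ι)
    (x : ι → R) : secondSymm univ (x ∘ e) = secondSymm univ x := by
  rw [← map_univ_equiv e, secondSymm_map]
  rfl

theorem secondSymm_sum {κ : Type*} [DecidableEq κ] [Fintype ι] [Fintype κ] (x : ι ⊕ κ → R) :
    secondSymm univ x = secondSymm univ (x ∘ Sum.inl) + secondSymm univ (x ∘ Sum.inr) +
      (∑ i, x (Sum.inl i)) * ∑ i, x (Sum.inr i) := by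
  have h : (univ : Finset (ι ⊕ κ)) =
      univ.map Function.Embedding.inl ∪ univ.map Function.Embedding.inr := by
    ext (i | i) <;> simp
  rw [h, secondSymm_disjUnion _ _ (by simp [Finset.disjoint_left]), secondSymm_map,
    secondSymm_map]
  simp
  rfl

theorem secondSymm_fin_succ {n : ℕ} (x : Fin (n + 1) → R) :
    secondSymm univ x =
      secondSymm univ (fun i : Fin n => x i.succ) + x 0 * ∑ i : Fin n, x i.succ := by
  rw [Fin.univ_succ, cons_eq_insert, secondSymm_insert (by simp), secondSymm_map]
  simp
  rfl

/-- The second elementary symmetric function as a quadratic form. -/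
noncomputable def secondSymmForm (ι R : Type*) [DecidableEq ι] [CommRing R] [Fintype ι] :
    QuadraticForm R (ι → R) :=
  QuadraticMap.ofPolar (secondSymm univ) (fun c x => secondSymm_smul univ c x)
    (fun x x' y => by
      simp only [QuadraticMap.polar, secondSymm_add, Pi.add_apply, sum_add_distrib, add_mul]; ring)
    (fun c x y => by
      simp only [QuadraticMap.polar, secondSymm_add, Pi.smul_apply, smul_eq_mul, mul_assoc,
        ← mul_sum]; ring)

theorem secondSymmForm_apply [Fintype ι] (x : ι → R) :
    secondSymmForm ι R x = secondSymm univ x := rfl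

theorem polar_secondSymmForm [Fintype ι] (x y : ι → R) :
    QuadraticMap.polar (secondSymmForm ι R) x y = (∑ i, x i) * (∑ i, y i) - ∑ i, x i * y i := by
  simp only [QuadraticMap.polar, secondSymmForm_apply, secondSymm_add]; ring

end MinorSum

/-! ### Totally singular spaces from binary codes -/

section Codes

open Module Finset

variable {K X : Type*} [Field K] [AddCommGroup X] [Module K X]

/-- `K^ι ⊥ X` has a `d`-dimensional subspace on which the sum of the `ι`-coordinates vanishes and
which is totally singular for the sum of the second elementary symmetric function and `r`. -/
def HasTotallySingular (ι : Type*) [Fintype ι] [DecidableEq ι] (r : QuadraticForm K X) (d : ℕ) :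
    Prop :=
  ∃ L : Submodule K ((ι → K) × X), finrank K L = d ∧
    ∀ x ∈ L, ∑ i, x.1 i = 0 ∧ secondSymm univ x.1 + r x.2 = 0

variable {ι κ : Type*} [Fintype ι] [DecidableEq ι] [Fintype κ] [DecidableEq κ]

theorem HasTotallySingular.of_injective {r : QuadraticForm K X} {d : ℕ}
    (f : (Fin d → K) →ₗ[K] (ι → K) × X) (hf : ∀ a, f a = 0 → a = 0)
    (h : ∀ a, ∑ i, (f a).1 i = 0) (h' : ∀ a, secondSymm univ (f a).1 + r (f a).2 = 0) :
    HasTotallySingular ι r d := by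
  refine ⟨LinearMap.range f, ?_, ?_⟩
  · rw [LinearMap.finrank_range_of_inj ((injective_iff_map_eq_zero f).mpr hf), finrank_fin_fun]
  · rintro _ ⟨a, rfl⟩
    exact ⟨h a, h' a⟩

theorem HasTotallySingular.congr {r : QuadraticForm K X} {d : ℕ} (h : HasTotallySingular ι r d)
    (e : κ ≃ ι) : HasTotallySingular κ r d := by
  obtain ⟨L, hL, h⟩ := h
  let g := (LinearEquiv.funCongrLeft K K e).prodCongr (LinearEquiv.refl K X)
  refine ⟨L.map g.toLinearMap, by rw [LinearEquiv.finrank_map_eq, hL], ?_⟩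
  rintro _ ⟨x, hx, rfl⟩
  obtain ⟨h1, h2⟩ := h x hx
  refine ⟨(Equiv.sum_comp e x.1).trans h1, ?_⟩
  rw [← secondSymm_comp_equiv e] at h2
  exact h2

/-- The second symmetric function of a concatenation has the product of the two coordinate sums as
its only cross term, and both sums vanish. -/
theorem HasTotallySingular.sum [FiniteDimensional K X] {r : QuadraticForm K X} {d d' : ℕ}
    (h : HasTotallySingular ι r d)
    {L' : Submodule K (κ → K)} (hd' : finrank K L' = d')
    (hL' : ∀ x ∈ L', ∑ i, x i = 0 ∧ secondSymm univ x = 0) :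
    HasTotallySingular (κ ⊕ ι) r (d' + d) := by
  obtain ⟨L, hL, h⟩ := h
  let e : ((κ → K) × ((ι → K) × X)) ≃ₗ[K] (κ ⊕ ι → K) × X :=
    (LinearEquiv.prodAssoc K (κ → K) (ι → K) X).symm.trans
      ((LinearEquiv.sumArrowLequivProdArrow κ ι K K).symm.prodCongr (LinearEquiv.refl K X))
  let f : L' × L →ₗ[K] (κ ⊕ ι → K) × X := e.toLinearMap ∘ₗ L'.subtype.prodMap L.subtype
  have hf : Function.Injective f :=
    e.injective.comp (L'.injective_subtype.prodMap L.injective_subtype)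
  refine ⟨LinearMap.range f, by rw [LinearMap.finrank_range_of_inj hf, finrank_prod, hL, hd'], ?_⟩
  rintro _ ⟨⟨⟨y, hy⟩, ⟨⟨x, p⟩, hx⟩⟩, rfl⟩
  have hfe : f (⟨y, hy⟩, ⟨(x, p), hx⟩) = (Sum.elim y x, p) := by
    simp only [f, e, LinearMap.comp_apply]
    ext i
    · rcases i with i | i <;> rfl
    · rfl
  obtain ⟨h1, h2⟩ := h _ hx
  obtain ⟨h3, h4⟩ := hL' y hy
  rw [hfe]
  dsimp only at h1 h2 ⊢
  refine ⟨by simp [h1, h3], ?_⟩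
  rw [secondSymm_sum, Sum.elim_comp_inl, Sum.elim_comp_inr, h4]
  simp only [Sum.elim_inl, Sum.elim_inr, h1, h3]
  linear_combination h2

theorem hasTotallySingular_fin_one :
    HasTotallySingular (Fin 1) (hyperbolicForm K 0) 0 :=
  .of_injective 0 (fun a _ => Subsingleton.elim _ _) (by simp)
    (by simp [secondSymm_singleton, hyperbolicForm_apply])

variable [CharP K 2]

/-- The extended Hamming code with scalars extended to `K`: its coordinates are linear forms in `x
0, …, x 3` with an odd number of `x 0, x 1, x 2`. A binary word of weight `w` has symmetric
functions `w` and `w(w-1)/2`, both even when `4 ∣ w`; for words of sum zero the polar form is the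
dot product, which vanishes as codewords overlap evenly. -/
theorem exists_totallySingular_fin_eight : ∃ L : Submodule K (Fin 8 → K), finrank K L = 4 ∧
    ∀ x ∈ L, ∑ i, x i = 0 ∧ secondSymm univ x = 0 := by
  have h2 := CharTwo.two_eq_zero (R := K)
  let f : (Fin 4 → K) →ₗ[K] (Fin 8 → K) :=
    { toFun x := ![x 0 + x 3, x 1 + x 3, x 2 + x 3, x 0 + x 1 + x 2 + x 3, x 0, x 1, x 2,
        x 0 + x 1 + x 2]
      map_add' x y := by ext i; fin_cases i <;> simp <;> ring
      map_smul' c x := by ext i; fin_cases i <;> simp <;> ring }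
  have hf (x : Fin 4 → K) : f x = ![x 0 + x 3, x 1 + x 3, x 2 + x 3, x 0 + x 1 + x 2 + x 3,
    x 0, x 1, x 2, x 0 + x 1 + x 2] := rfl
  have hinj : Function.Injective f := by
    rw [injective_iff_map_eq_zero]
    intro x hx
    have h0 := congrFun hx 0
    have h4 := congrFun hx 4
    have h5 := congrFun hx 5
    have h6 := congrFun hx 6
    simp [hf] at h0 h4 h5 h6
    ext i; fin_cases i <;> simp_all
  refine ⟨LinearMap.range f, by rw [LinearMap.finrank_range_of_inj hinj, finrank_fin_fun], ?_⟩
  rintro _ ⟨x, rfl⟩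
  rw [hf]
  constructor
  · simp [Fin.sum_univ_succ]
    linear_combination (2 * x 0 + 2 * x 3 + 2 * x 1 + 2 * x 2) * h2
  · simp [secondSymm_fin_succ, Fin.sum_univ_succ, secondSymm_singleton]
    linear_combination (7 * x 0 * x 1 + 7 * x 1 * x 3 + 7 * x 0 * x 3 + 3 * x 3 * x 3 +
      7 * x 0 * x 2 + 7 * x 2 * x 3 + 7 * x 1 * x 2 + 3 * x 0 * x 0 + 3 * x 1 * x 1 +
      3 * x 2 * x 2) * h2

/-- The simplex code: the coordinates are the seven nonzero binary linear forms in three variables,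
so every nonzero binary codeword has weight four. -/
theorem hasTotallySingular_fin_seven :
    HasTotallySingular (Fin 7) (hyperbolicForm K 0) 3 := by
  have h2 := CharTwo.two_eq_zero (R := K)
  let f : (Fin 3 → K) →ₗ[K] (Fin 7 → K) :=
    { toFun x := ![x 0 + x 2, x 1 + x 2, x 0 + x 1 + x 2, x 2, x 0, x 1, x 0 + x 1]
      map_add' x y := by ext i; fin_cases i <;> simp <;> ring
      map_smul' c x := by ext i; fin_cases i <;> simp <;> ring }
  have hf (x : Fin 3 → K) : f x =
    ![x 0 + x 2, x 1 + x 2, x 0 + x 1 + x 2, x 2, x 0, x 1, x 0 + x 1] := rfl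
  refine .of_injective (LinearMap.inl K _ _ ∘ₗ f) (fun x hx => ?_) (fun x => ?_) (fun x => ?_)
  · replace hx : f x = 0 := congrArg Prod.fst hx
    have h3 := congrFun hx 3
    have h4 := congrFun hx 4
    have h5 := congrFun hx 5
    simp [hf] at h3 h4 h5
    ext i; fin_cases i <;> simp_all
  · simp [Fin.sum_univ_succ, hf]
    linear_combination (2 * x 0 + 2 * x 2 + 2 * x 1) * h2
  · simp [secondSymm_fin_succ, Fin.sum_univ_succ, secondSymm_singleton, hf,
      hyperbolicForm_apply]
    linear_combination (7 * x 0 * x 1 + 7 * x 1 * x 2 + 7 * x 0 * x 2 + 3 * x 2 * x 2 +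
      3 * x 0 * x 0 + 3 * x 1 * x 1) * h2

/-- On `(x, y, x + y)` the second symmetric function is `x² + xy + y²` in characteristic two, so the
graph of this isometry with `[1,1]` is totally singular. -/
theorem hasTotallySingular_fin_three :
    HasTotallySingular (Fin 3) (binaryForm (1 : K) 1) 2 := by
  have h2 := CharTwo.two_eq_zero (R := K)
  let f : (Fin 2 → K) →ₗ[K] (Fin 3 → K) × (K × K) :=
    { toFun x := (![x 0, x 1, x 0 + x 1], (x 0, x 1))
      map_add' x y := by
        refine Prod.ext ?_ rfl
        ext i; fin_cases i <;> simp; ring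
      map_smul' c x := by
        refine Prod.ext ?_ rfl
        ext i; fin_cases i <;> simp; ring }
  have hf (x : Fin 2 → K) : f x = (![x 0, x 1, x 0 + x 1], (x 0, x 1)) := rfl
  refine .of_injective f (fun x hx => ?_) (fun x => ?_) (fun x => ?_)
  · simp [hf] at hx
    ext i; fin_cases i <;> simp_all
  · simp [Fin.sum_univ_succ, hf]
    linear_combination (x 0 + x 1) * h2
  · simp [secondSymm_fin_succ, Fin.sum_univ_succ, secondSymm_singleton, hf, binaryForm_apply]
    linear_combination (2 * x 0 * x 1 + x 0 * x 0 + x 1 * x 1) * h2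

/-- The graph used for length three, enlarged by the weight-four word `(1,1,1,1,0)`. -/
theorem hasTotallySingular_fin_five :
    HasTotallySingular (Fin 5) (binaryForm (1 : K) 1) 3 := by
  have h2 := CharTwo.two_eq_zero (R := K)
  let f : (Fin 3 → K) →ₗ[K] (Fin 5 → K) × (K × K) :=
    { toFun x := (![x 0 + x 2, x 1 + x 2, x 0 + x 1 + x 2, x 2, 0], (x 0, x 1))
      map_add' x y := by
        refine Prod.ext ?_ rfl
        ext i; fin_cases i <;> simp <;> ring
      map_smul' c x := by
        refine Prod.ext ?_ rfl
        ext i; fin_cases i <;> simp <;> ring }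
  have hf (x : Fin 3 → K) : f x =
    (![x 0 + x 2, x 1 + x 2, x 0 + x 1 + x 2, x 2, 0], (x 0, x 1)) := rfl
  refine .of_injective f (fun x hx => ?_) (fun x => ?_) (fun x => ?_)
  · simp [hf] at hx
    ext i; fin_cases i <;> simp_all
  · simp [Fin.sum_univ_succ, hf]
    linear_combination (x 0 + 2 * x 2 + x 1) * h2
  · simp [secondSymm_fin_succ, Fin.sum_univ_succ, secondSymm_singleton, hf, binaryForm_apply]
    linear_combination (2 * x 0 * x 1 + 3 * x 1 * x 2 + 3 * x 0 * x 2 + 3 * x 2 * x 2 +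
      x 0 * x 0 + x 1 * x 1) * h2

theorem HasTotallySingular.add_eight_mul [FiniteDimensional K X] {r : QuadraticForm K X} {n d : ℕ}
    (h : HasTotallySingular (Fin n) r d) (k : ℕ) :
    HasTotallySingular (Fin (8 * k + n)) r (4 * k + d) := by
  induction k with
  | zero => simpa using h.congr (finCongr (by simp))
  | succ k ih =>
    obtain ⟨L', hd', hL'⟩ := exists_totallySingular_fin_eight (K := K)
    have h := (ih.sum hd' hL').congr 
      (finSumFinEquiv.trans (finCongr (show 8 + (8 * k + n) = 8 * (k + 1) + n by ring))).symm
    rwa [show 4 * (k + 1) + d = 4 + (4 * k + d) by ring]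

theorem hasTotallySingular_of_one_or_seven {n m : ℕ} (hm : n = 2 * m + 1)
    (h : n % 8 = 1 ∨ n % 8 = 7) (hι : Fintype.card ι = n) :
    HasTotallySingular ι (hyperbolicForm K 0) m := by
  rcases h with h | h
  · have h1 := (hasTotallySingular_fin_one (K := K)).add_eight_mul (n / 8)
    rw [show m = 4 * (n / 8) + 0 by omega]
    exact h1.congr (Fintype.equivFinOfCardEq (by omega))
  · have h1 := (hasTotallySingular_fin_seven (K := K)).add_eight_mul (n / 8)
    rw [show m = 4 * (n / 8) + 3 by omega]
    exact h1.congr (Fintype.equivFinOfCardEq (by omega))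

theorem hasTotallySingular_of_three_or_five {n m : ℕ} (hm : n = 2 * m + 1)
    (h : n % 8 = 3 ∨ n % 8 = 5) (hι : Fintype.card ι = n) :
    HasTotallySingular ι (binaryForm (1 : K) 1) (m + 1) := by
  rcases h with h | h
  · have h1 := (hasTotallySingular_fin_three (K := K)).add_eight_mul (n / 8)
    rw [show m + 1 = 4 * (n / 8) + 2 by omega]
    exact h1.congr (Fintype.equivFinOfCardEq (by omega))
  · have h1 := (hasTotallySingular_fin_five (K := K)).add_eight_mul (n / 8)
    rw [show m + 1 = 4 * (n / 8) + 3 by omega]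
    exact h1.congr (Fintype.equivFinOfCardEq (by omega))

end Codes

/-! ### The second trace form of an odd degree Galois extension -/

section GaloisForm

open Module Finset

set_option linter.unusedSectionVars false

theorem cast_eq_one_of_charTwo (K : Type*) [Field K] [CharP K 2] {n m : ℕ} (h : n = 2 * m + 1) :
    (n : K) = 1 := by
  rw [h]
  push_cast
  linear_combination (m : K) * (CharTwo.two_eq_zero (R := K))

/-- The space of vectors with coordinate sum zero. -/
noncomputable def sumZero (ι K : Type*) [Fintype ι] [Field K] : Submodule K (ι → K) :=
  LinearMap.ker (∑ i, LinearMap.proj i : (ι → K) →ₗ[K] K)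

theorem mem_sumZero {ι K : Type*} [Fintype ι] [Field K] (x : ι → K) :
    x ∈ sumZero ι K ↔ ∑ i, x i = 0 := by
  simp [sumZero]

theorem finrank_sumZero_add_one {ι K : Type*} [Fintype ι] [Field K] [Nonempty ι] :
    finrank K (sumZero ι K) + 1 = Fintype.card ι := by
  classical
  rw [sumZero, Module.Dual.finrank_ker_add_one_of_ne_zero, finrank_fintype_fun_eq_card]
  intro h
  have := LinearMap.congr_fun h (Pi.single (Classical.arbitrary ι) 1)
  simp at this

theorem nondegenerate_secondSymmForm_sumZero {ι K : Type*} [Fintype ι] [DecidableEq ι] [Field K]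
    [CharP K 2] {m : ℕ} (h : Fintype.card ι = 2 * m + 1) :
    ((secondSymmForm ι K).comp (sumZero ι K).subtype).polarBilin.Nondegenerate := by
  refine nondegenerate_polarBilin fun x hx => ?_
  have hx0 := (mem_sumZero x.1).mp x.2
  ext i
  -- Subtracting the all-ones vector makes the coordinate sum `1 - n`, which is zero as `n` is odd,
  -- and does not change the pairing with a vector of sum zero.
  let y : ι → K := Pi.single i 1 - 1
  have hy : y ∈ sumZero ι K := by
    rw [mem_sumZero]
    simp [y, cast_eq_one_of_charTwo K h]
  have h1 := hx ⟨y, hy⟩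
  rw [← polar_isometric (T := secondSymmForm ι K) (sumZero ι K).subtype (fun _ => rfl),
    polar_secondSymmForm] at h1
  simpa [y, mul_sub, hx0, Pi.single_apply] using h1

variable {F E : Type*} [Field F] [Field E] [Algebra F E] [FiniteDimensional F E] [IsGalois F E]

variable (F E) in
/-- The vector of conjugates. -/
noncomputable def conjugates : E →ₗ[F] (Gal(E/F) → E) :=
  LinearMap.pi fun σ => σ.toLinearMap

theorem conjugates_apply (x : E) (σ : Gal(E/F)) : conjugates F E x σ = σ x := rfl

theorem sum_conjugates (x : E) :
    ∑ σ, conjugates F E x σ = algebraMap F E (Algebra.trace F E x) :=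
  (trace_eq_sum_automorphisms x).symm

/-- The Galois group permutes the conjugates, so the symmetric function is fixed by it. -/
theorem exists_secondSymm_conjugates [DecidableEq Gal(E/F)] (x : E) :
    ∃ c : F, algebraMap F E c = secondSymm univ (conjugates F E x) := by
  rw [← Set.mem_range, IsGalois.mem_range_algebraMap_iff_fixed]
  intro τ
  have h := map_secondSymm (τ : E →+* E) univ (conjugates F E x)
  exact h.trans (secondSymm_comp_equiv (Equiv.mulLeft τ) (conjugates F E x))

variable (F E) in
/-- The second elementary symmetric function of the conjugates, as a quadratic form over the
base field. -/
theorem exists_conjugatesForm [DecidableEq Gal(E/F)] : ∃ Q : QuadraticForm F E,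
    ∀ x, algebraMap F E (Q x) = secondSymm univ (conjugates F E x) := by
  choose q hq using exists_secondSymm_conjugates (F := F) (E := E)
  have hp (x y : E) : QuadraticMap.polar q x y =
      Algebra.trace F E x * Algebra.trace F E y - Algebra.trace F E (x * y) := by
    apply (algebraMap F E).injective
    simp only [QuadraticMap.polar, map_sub, hq, map_add, secondSymm_add, map_mul, sum_conjugates]
    rw [← sum_conjugates (x * y)]
    simp only [conjugates_apply, map_mul]
    ring
  exact ⟨QuadraticMap.ofPolar q
    (fun c x => by
      apply (algebraMap F E).injective
      rw [hq, map_smul, ← algebraMap_smul E c (conjugates F E x), secondSymm_smul, ← hq]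
      simp)
    (fun x x' y => by simp only [hp, map_add, add_mul]; ring)
    (fun c x y => by simp only [hp, map_smul, smul_eq_mul, Algebra.smul_mul_assoc]; ring), hq⟩

theorem polar_conjugatesForm [DecidableEq Gal(E/F)] {Q : QuadraticForm F E}
    (hQ : ∀ x, algebraMap F E (Q x) = secondSymm univ (conjugates F E x)) (x y : E) :
    QuadraticMap.polar Q x y =
      Algebra.trace F E x * Algebra.trace F E y - Algebra.trace F E (x * y) := by
  apply (algebraMap F E).injective
  simp only [QuadraticMap.polar, map_sub, hQ, map_add, secondSymm_add, map_mul, sum_conjugates]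
  rw [← sum_conjugates (x * y)]
  simp only [conjugates_apply, map_mul]
  ring

variable (F E) in
/-- The elements of trace zero. -/
noncomputable abbrev traceZero : Submodule F E := LinearMap.ker (Algebra.trace F E)

variable (F E) in
theorem finrank_traceZero_add_one : finrank F (traceZero F E) + 1 = finrank F E :=
  Module.Dual.finrank_ker_add_one_of_ne_zero (Algebra.trace_ne_zero F E)

theorem nondegenerate_conjugatesForm [CharP F 2] [DecidableEq Gal(E/F)] {m : ℕ}
    (hm : finrank F E = 2 * m + 1) {Q : QuadraticForm F E}
    (hQ : ∀ x, algebraMap F E (Q x) = secondSymm univ (conjugates F E x)) :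
    (Q.comp (traceZero F E).subtype).polarBilin.Nondegenerate := by
  refine nondegenerate_polarBilin fun x hx => Subtype.ext ?_
  refine (traceForm_nondegenerate F E).1 x.1 fun y => ?_
  rw [Algebra.traceForm_apply]
  have hx0 : Algebra.trace F E x = 0 := x.2
  -- Subtracting `tr y` makes the trace zero because `n = 1` in `F`, and costs nothing when pairing
  -- with an element of trace zero.
  have h1 := hx ⟨y - algebraMap F E (Algebra.trace F E y), by
    simp [Algebra.trace_algebraMap, cast_eq_one_of_charTwo F hm]⟩
  rw [← polar_isometric (T := Q) (traceZero F E).subtype (fun _ => rfl),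
    polar_conjugatesForm hQ] at h1
  simp only [Submodule.subtype_apply, hx0, mul_sub, map_sub] at h1
  rw [mul_comm (x : E) (algebraMap F E _), ← Algebra.smul_def, map_smul, hx0] at h1
  simpa using h1

variable (F E) in
/-- The vector of conjugates of an element of trace zero. -/
noncomputable def conjugatesZero : traceZero F E →ₗ[F] sumZero Gal(E/F) E :=
  LinearMap.codRestrict ((sumZero Gal(E/F) E).restrictScalars F)
    (conjugates F E ∘ₗ (traceZero F E).subtype) fun x => by
      rw [Submodule.restrictScalars_mem, mem_sumZero, LinearMap.comp_apply, sum_conjugates]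
      simp

/-- Injectivity of `E ⊗ E → E^G`: applying each `τ` to the component at `τ⁻¹` gives a Vandermonde
system in the distinct conjugates of the generator. -/
theorem eq_zero_of_sum_pow_smul_conjugates (pb : PowerBasis F E) (v : Fin pb.dim → E)
    (h : ∑ i : Fin pb.dim, pb.gen ^ (i : ℕ) • conjugates F E (v i) = 0) : v = 0 := by
  have hcard : Fintype.card Gal(E/F) = pb.dim := by
    rw [← pb.finrank, ← IsGalois.card_aut_eq_finrank F E, Nat.card_eq_fintype_card]
  let e := (Fintype.equivFinOfCardEq hcard).symm
  refine Matrix.eq_zero_of_forall_index_sum_pow_mul_eq_zero (f := fun k => e k pb.gen) ?_ ?_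
  · intro k l hkl
    apply e.injective
    apply AlgEquiv.coe_toAlgHom_injective
    exact pb.algHom_ext hkl
  · intro k
    have h1 := congrArg (e k) (congrFun h (e k)⁻¹)
    simp only [Finset.sum_apply, Pi.smul_apply, conjugates_apply, smul_eq_mul, map_sum, map_mul,
      map_pow, Pi.zero_apply, map_zero, AlgEquiv.aut_inv,
      AlgEquiv.apply_symm_apply] at h1
    exact h1

/-- The extra summand `r` lets `[1,1]` be added before descending, so that the explicit spaces over
`E` serve both residue cases. -/
theorem exists_lagrangian_traceZero_prod [CharP F 2] [DecidableEq Gal(E/F)] {m : ℕ}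
    (hm : finrank F E = 2 * m + 1) {Q : QuadraticForm F E}
    (hQ : ∀ x, algebraMap F E (Q x) = secondSymm univ (conjugates F E x)) (pb : PowerBasis F E)
    {X XE : Type*} [AddCommGroup X] [Module F X] [FiniteDimensional F X] [AddCommGroup XE]
    [Module E XE] [Module F XE] [IsScalarTower F E XE] [FiniteDimensional E XE]
    {r : QuadraticForm F X} (hr : r.polarBilin.Nondegenerate) {rE : QuadraticForm E XE}
    (hrE : rE.polarBilin.Nondegenerate) (j : X →ₗ[F] XE)
    (hj : ∀ x, rE (j x) = algebraMap F E (r x))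
    (hinj : ∀ v : Fin pb.dim → X, ∑ i : Fin pb.dim, pb.gen ^ (i : ℕ) • j (v i) = 0 → v = 0)
    (hfin : finrank E XE = finrank F X) {d : ℕ} (hd : 2 * d = 2 * m + finrank F X)
    (h : HasTotallySingular Gal(E/F) rE d) :
    ∃ L : Submodule F (traceZero F E × X),
      (∀ x ∈ L, (Q.comp (traceZero F E).subtype).prod r x = 0) ∧ finrank F L = d := by
  have : CharP E 2 := charP_of_injective_algebraMap (algebraMap F E).injective 2
  have hcard : Fintype.card Gal(E/F) = 2 * m + 1 := by
    rw [← hm, ← IsGalois.card_aut_eq_finrank F E, Nat.card_eq_fintype_card]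
  have hfin1 := finrank_traceZero_add_one F E
  have hfin2 := finrank_sumZero_add_one (ι := Gal(E/F)) (K := E)
  obtain ⟨L, hLd, hL⟩ := h
  let g : (sumZero Gal(E/F) E) × XE →ₗ[E] (Gal(E/F) → E) × XE :=
    (sumZero Gal(E/F) E).subtype.prodMap LinearMap.id
  have hg : Function.Injective g :=
    (Submodule.injective_subtype _).prodMap Function.injective_id
  have hLg : (L.comap g).map g = L := by
    rw [Submodule.map_comap_eq, inf_eq_right]
    rintro ⟨x, p⟩ hx
    exact ⟨(⟨x, (mem_sumZero x).mpr (hL _ hx).1⟩, p), rfl⟩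
  have hLg' : finrank E (L.comap g) = d := by
    rw [(Submodule.equivMapOfInjective g hg _).finrank_eq, hLg, hLd]
  obtain ⟨L', hL', hdL'⟩ := exists_lagrangian_of_odd_extension
    (nondegenerate_prod (nondegenerate_conjugatesForm hm hQ) hr)
    (nondegenerate_prod (nondegenerate_secondSymmForm_sumZero hcard) hrE) pb
    (by rw [← pb.finrank, hm]) ((conjugatesZero F E).prodMap j)
    (fun v => by
      simp only [QuadraticMap.prod_apply, LinearMap.prodMap_apply, hj, map_add,
        QuadraticMap.comp_apply, hQ]
      rfl)
    (fun v hv => by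
      have h1 := congrArg (fun z => ((Prod.fst z : sumZero Gal(E/F) E) : Gal(E/F) → E)) hv
      have h2 := congrArg Prod.snd hv
      simp only [Prod.fst_sum, Prod.snd_sum, Prod.smul_fst, Prod.smul_snd,
        LinearMap.prodMap_apply, Submodule.coe_sum, Submodule.coe_smul] at h1 h2
      have h3 := eq_zero_of_sum_pow_smul_conjugates pb (fun i => ((v i).1 : E)) h1
      have h4 := hinj (fun i => (v i).2) h2
      funext i
      exact Prod.ext (Subtype.ext (congrFun h3 i)) (congrFun h4 i))
    (by rw [finrank_prod, finrank_prod]; omega)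
    (L := L.comap g) (fun x hx => by
      simp only [QuadraticMap.prod_apply]
      exact (hL _ hx).2)
    (by rw [hLg', finrank_prod]; omega)
  rw [finrank_prod] at hdL'
  exact ⟨L', hL', by omega⟩

/-- The second trace form of an odd Galois extension, for degree `±1` modulo `8`. -/
theorem conjugatesForm_equivalent_of_one_or_seven [CharP F 2] [DecidableEq Gal(E/F)] {n m : ℕ}
    (hn : finrank F E = n) (hm : n = 2 * m + 1) (h : n % 8 = 1 ∨ n % 8 = 7)
    {Q : QuadraticForm F E}
    (hQ : ∀ x, algebraMap F E (Q x) = secondSymm univ (conjugates F E x)) :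
    (Q.comp (traceZero F E).subtype).Equivalent (hyperbolicForm F m) := by
  have : CharP E 2 := charP_of_injective_algebraMap (algebraMap F E).injective 2
  have hcard : Fintype.card Gal(E/F) = n := by
    rw [← hn, ← IsGalois.card_aut_eq_finrank F E, Nat.card_eq_fintype_card]
  have hfin1 := finrank_traceZero_add_one F E
  -- No auxiliary form is needed here; the zero-dimensional `hyperbolicForm 0` takes its place.
  obtain ⟨L, hL, hLd⟩ := exists_lagrangian_traceZero_prod (hn.trans hm) hQ
    (Field.powerBasisOfFiniteOfSeparable F E) (nondegenerate_hyperbolicForm (F := F) 0)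
    (nondegenerate_hyperbolicForm (F := E) 0) 0
    (fun x => by simp [hyperbolicForm_apply]) (fun v _ => Subsingleton.elim _ _)
    (by rw [finrank_zero_of_subsingleton, finrank_zero_of_subsingleton]) (d := m)
    (by rw [finrank_zero_of_subsingleton (M := Fin 0 → F × F)]; omega)
    (hasTotallySingular_of_one_or_seven hm h hcard)
  refine (prod_hyperbolicForm_zero_equivalent _).symm.trans
    (equivalent_hyperbolicForm_of_lagrangian (nondegenerate_prod
      (nondegenerate_conjugatesForm (hn.trans hm) hQ) (nondegenerate_hyperbolicForm 0)) hL hLd ?_)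
  rw [finrank_prod, finrank_zero_of_subsingleton (M := Fin 0 → F × F)]
  omega

/-- The second trace form of an odd Galois extension, for degree `±3` modulo `8`. -/
theorem conjugatesForm_equivalent_of_three_or_five [CharP F 2] [DecidableEq Gal(E/F)] {n m : ℕ}
    (hn : finrank F E = n) (hm : n = 2 * m + 1) (h : n % 8 = 3 ∨ n % 8 = 5)
    {Q : QuadraticForm F E}
    (hQ : ∀ x, algebraMap F E (Q x) = secondSymm univ (conjugates F E x)) :
    (Q.comp (traceZero F E).subtype).Equivalent
      ((binaryForm (1 : F) 1).prod (hyperbolicForm F (m - 1))) := by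
  have : CharP E 2 := charP_of_injective_algebraMap (algebraMap F E).injective 2
  have hcard : Fintype.card Gal(E/F) = n := by
    rw [← hn, ← IsGalois.card_aut_eq_finrank F E, Nat.card_eq_fintype_card]
  have hfin1 := finrank_traceZero_add_one F E
  let pb := Field.powerBasisOfFiniteOfSeparable F E
  have hpb (c : Fin pb.dim → F)
      (hc : ∑ i : Fin pb.dim, pb.gen ^ (i : ℕ) * algebraMap F E (c i) = 0)
      (i : Fin pb.dim) : c i = 0 := by
    refine Fintype.linearIndependent_iff.mp pb.basis.linearIndependent c ?_ i
    rw [← hc]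
    refine sum_congr rfl fun i _ => ?_
    rw [pb.basis_eq_pow, Algebra.smul_def, mul_comm]
  obtain ⟨L, hL, hLd⟩ := exists_lagrangian_traceZero_prod (hn.trans hm) hQ pb
    (nondegenerate_binaryForm (1 : F) 1) (nondegenerate_binaryForm (1 : E) 1)
    ((Algebra.linearMap F E).prodMap (Algebra.linearMap F E))
    (fun x => by
      obtain ⟨a, b⟩ := x
      simp [binaryForm_apply])
    (fun v hv => by
      have h1 := congrArg Prod.fst hv
      have h2 := congrArg Prod.snd hv
      simp only [Prod.fst_sum, Prod.snd_sum, Prod.smul_fst, Prod.smul_snd,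
        LinearMap.prodMap_apply, Algebra.linearMap_apply, smul_eq_mul] at h1 h2
      funext i
      exact Prod.ext (hpb _ h1 i) (hpb _ h2 i))
    (by simp) (d := m + 1) (by simp; ring)
    (hasTotallySingular_of_three_or_five hm h hcard)
  exact equivalent_binaryForm_prod_of_lagrangian (nondegenerate_conjugatesForm (hn.trans hm) hQ)
    (by omega) (by omega) hL hLd

end GaloisForm

/-! ### The splitting of a crossed product -/

section SkolemNoether

theorem Matrix.charpoly_algEquiv {ι K : Type*} [Fintype ι] [DecidableEq ι] [Field K]
    (f : Matrix ι ι K ≃ₐ[K] Matrix ι ι K) (M : Matrix ι ι K) : (f M).charpoly = M.charpoly := by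
  obtain ⟨T, hT⟩ := AlgEquiv.eq_linearEquivConjAlgEquiv
    ((Matrix.toLinAlgEquiv'.symm.trans f).trans Matrix.toLinAlgEquiv')
  have h := AlgEquiv.congr_fun hT (Matrix.toLinAlgEquiv' M)
  simp only [AlgEquiv.trans_apply, AlgEquiv.symm_apply_apply] at h
  rw [← Matrix.charpoly_toLin' M, ← Matrix.charpoly_toLin' (f M),
    ← T.charpoly_conj (Matrix.toLin' M)]
  exact congrArg LinearMap.charpoly h

/-- Two splittings differ by an automorphism of a matrix algebra, which is inner and preserves
characteristic polynomials. Hence the arbitrarily chosen splitting may be replaced by an explicit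
one. -/
theorem charpoly_splittingRep {F A ι : Type*} [Field F] [Ring A] [Algebra F A] [Fintype ι]
    [DecidableEq ι] (hι : Fintype.card ι = csaDegree F A)
    (f : AlgebraicClosure F ⊗[F] A ≃ₐ[AlgebraicClosure F] Matrix ι ι (AlgebraicClosure F))
    (a : A) : (splittingRep F A a).charpoly = (f (1 ⊗ₜ a)).charpoly := by
  let e := Fintype.equivFinOfCardEq hι
  let g : Splitting F A := f.trans (Matrix.reindexAlgEquiv (AlgebraicClosure F) _ e)
  have hne : Nonempty (Splitting F A) := ⟨g⟩
  have h1 : splittingRep F A a = hne.some (1 ⊗ₜ a) := by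
    rw [splittingRep, dif_pos hne]
    rfl
  have h2 := Matrix.charpoly_algEquiv (g.symm.trans hne.some) (g (1 ⊗ₜ a))
  rw [AlgEquiv.trans_apply, AlgEquiv.symm_apply_apply] at h2
  rw [h1, h2]
  exact Matrix.charpoly_reindex e _

end SkolemNoether

/-! ### Regular representation, reduced trace and `t_2` of a crossed product -/

namespace CrossedProduct

open Module Finset

set_option linter.unusedSectionVars false

variable {F : Type u} {E : Type v} [Field F] [Field E] [Algebra F E] [FiniteDimensional F E]
  {Φ : Gal(E/F) × Gal(E/F) → Eˣ} (hΦ : IsMulCocycle₂ Φ)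

/-- The left multiplication of the crossed product on itself, as a matrix over `E` acting from the
right, with respect to the basis `u τ`. -/
noncomputable def regularRep [DecidableEq Gal(E/F)] :
    CrossedProduct hΦ →ₐ[F] Matrix Gal(E/F) Gal(E/F) E :=
  AlgHom.ofLinearMap
    { toFun x := Matrix.of fun ρ τ => ρ⁻¹ (x (ρ * τ⁻¹) * (Φ (ρ * τ⁻¹, τ) : E))
      map_add' x y := by ext; simp [add_mul]
      map_smul' c x := by ext; simp }
    (by
      ext ρ τ
      by_cases h : ρ = τ
      · subst h
        have h1 : Φ (1, ρ) = Φ (1, 1) := map_one_fst_of_isMulCocycle₂ hΦ ρ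
        simp [one_def, single_apply, h1]
      · have h' : ρ * τ⁻¹ ≠ 1 := fun h' => h (mul_inv_eq_one.mp h')
        simp [one_def, single_apply, h, h'])
    (fun x y => by
      ext ρ τ
      simp only [LinearMap.coe_mk, AddHom.coe_mk, Matrix.of_apply, Matrix.mul_apply, mul_apply,
        sum_mul, map_sum]
      rw [← Equiv.sum_comp ((Equiv.inv _).trans (Equiv.mulLeft ρ))]
      refine sum_congr rfl fun κ _ => ?_
      have h := cocycle_coe hΦ (ρ * κ⁻¹) (κ * τ⁻¹) τ
      have h3 : ρ * κ⁻¹ * (κ * τ⁻¹) = ρ * τ⁻¹ := by group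
      have h4 : (ρ * κ⁻¹)⁻¹ * (ρ * τ⁻¹) = κ * τ⁻¹ := by group
      have h5 (z : E) : κ⁻¹ z = ρ⁻¹ ((ρ * κ⁻¹) z) := by
        rw [← AlgEquiv.mul_apply]; congr 1; group
      simp only [Equiv.trans_apply, Equiv.inv_apply, Equiv.coe_mulLeft]
      rw [h5, ← map_mul, h4, map_mul (ρ * κ⁻¹)]
      rw [h3, inv_mul_cancel_right] at h
      congr 1
      linear_combination (x (ρ * κ⁻¹) * (ρ * κ⁻¹) (y (κ * τ⁻¹))) * h)

theorem regularRep_apply [DecidableEq Gal(E/F)] (x : CrossedProduct hΦ) (ρ τ : Gal(E/F)) :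
    regularRep hΦ x ρ τ = ρ⁻¹ (x (ρ * τ⁻¹) * (Φ (ρ * τ⁻¹, τ) : E)) := rfl

/-- The diagonal sees only the coefficient of `u 1`. As `u 1 = Φ(1,1) · 1`, the factor `Φ(1,1)`
turns that coefficient into the corresponding element of `E`. -/
theorem regularRep_apply_diag [DecidableEq Gal(E/F)] (x : CrossedProduct hΦ) (ρ : Gal(E/F)) :
    regularRep hΦ x ρ ρ = ρ⁻¹ (x 1 * (Φ (1, 1) : E)) := by
  rw [regularRep_apply, mul_inv_cancel, map_one_fst_of_isMulCocycle₂ hΦ ρ]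

variable [IsGalois F E]

theorem card_gal : Fintype.card Gal(E/F) = finrank F E := by
  rw [← IsGalois.card_aut_eq_finrank F E, Nat.card_eq_fintype_card]

theorem finrank_crossedProduct :
    finrank F (CrossedProduct hΦ) = finrank F E * finrank F E := by
  change finrank F (Gal(E/F) → E) = _
  rw [finrank_pi_fintype, sum_const, card_univ, card_gal, smul_eq_mul]

instance : FiniteDimensional F (CrossedProduct hΦ) :=
  inferInstanceAs (FiniteDimensional F (Gal(E/F) → E))

theorem csaDegree_crossedProduct : csaDegree F (CrossedProduct hΦ) = finrank F E := by
  rw [csaDegree, finrank_crossedProduct, Nat.sqrt_eq]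

/-- A field containing `E` splits the crossed product. -/
theorem exists_splitting [DecidableEq Gal(E/F)] {K : Type*} [Field K] [Algebra F K]
    (i : E →ₐ[F] K) : ∃ f : K ⊗[F] CrossedProduct hΦ ≃ₐ[K] Matrix Gal(E/F) Gal(E/F) K,
      ∀ a, f (1 ⊗ₜ a) = (regularRep hΦ a).map i := by
  let f : K ⊗[F] CrossedProduct hΦ →ₐ[K] Matrix Gal(E/F) Gal(E/F) K :=
    Algebra.TensorProduct.lift (Algebra.ofId K _) (i.mapMatrix.comp (regularRep hΦ))
      fun c x => Algebra.commutes c _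
  have hf (c : K) (a : CrossedProduct hΦ) : f (c ⊗ₜ a) = c • (regularRep hΦ a).map i := by
    simp [f, Algebra.smul_def]
    rfl
  let pb := Field.powerBasisOfFiniteOfSeparable F E
  let b : Basis (Σ _ : Gal(E/F), Fin pb.dim) F (CrossedProduct hΦ) :=
    Pi.basis fun _ => pb.basis
  have hb (s : Σ _ : Gal(E/F), Fin pb.dim) (σ : Gal(E/F)) :
      b s σ = if s.1 = σ then pb.gen ^ (s.2 : ℕ) else 0 := by
    obtain ⟨σ', k⟩ := s
    have h : b ⟨σ', k⟩ = Pi.single σ' (pb.basis k) := Pi.basis_apply _ _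
    rw [h, Pi.single_apply, pb.basis_eq_pow]
    simp [eq_comm]
  have hinj : Function.Injective f := by
    rw [injective_iff_map_eq_zero]
    intro z hz
    let c := (Algebra.TensorProduct.basis K b).repr z
    suffices h : ∀ σ, (fun k => c ⟨σ, k⟩) = 0 by
      have : c = 0 := Finsupp.ext fun s => congrFun (h s.1) s.2
      exact (Algebra.TensorProduct.basis K b).repr.map_eq_zero_iff.mp this
    intro σ
    have hcard : Fintype.card Gal(E/F) = pb.dim := by rw [card_gal, pb.finrank]
    let e := (Fintype.equivFinOfCardEq hcard).symm
    refine Matrix.eq_zero_of_forall_index_sum_pow_mul_eq_zero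
      (f := fun k => i (e k pb.gen)) ?_ fun k => ?_
    · intro k l hkl
      apply e.injective
      apply AlgEquiv.coe_toAlgHom_injective
      exact pb.algHom_ext (i.toRingHom.injective hkl)
    · have h1 := (Algebra.TensorProduct.basis K b).sum_repr z
      rw [← h1, map_sum] at hz
      -- The entries at `(ρ, σ⁻¹ρ)` involve only the coefficient at `σ`. Letting `ρ` vary produces
      -- its conjugates, a Vandermonde system for the coordinates `c ⟨σ, ·⟩`.
      have h2 := congrFun (congrFun hz (e k)⁻¹) (σ⁻¹ * (e k)⁻¹)
      have h3 : (e k)⁻¹ * (σ⁻¹ * (e k)⁻¹)⁻¹ = σ := by group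
      simp only [map_smul, Algebra.TensorProduct.basis_apply, hf, one_smul, Matrix.sum_apply,
        Matrix.smul_apply, Matrix.map_apply, regularRep_apply, h3, hb, Matrix.zero_apply,
        Fintype.sum_sigma] at h2
      rw [Finset.sum_eq_single σ (fun τ _ hτ => by simp [hτ]) (by simp)] at h2
      simp only [if_true, inv_inv, map_mul, map_pow, smul_eq_mul, ← mul_assoc, ← sum_mul] at h2
      rcases mul_eq_zero.mp h2 with h | h
      · rw [← h]
        exact sum_congr rfl fun _ _ => mul_comm _ _
      · simp at h
  have hfin : finrank K (K ⊗[F] CrossedProduct hΦ) = finrank K (Matrix Gal(E/F) Gal(E/F) K) := by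
    rw [finrank_baseChange, finrank_crossedProduct, finrank_matrix, card_gal, finrank_self, mul_one]
  have hbij : Function.Bijective f :=
    ⟨hinj, (LinearMap.injective_iff_surjective_of_finrank_eq_finrank hfin (f := f.toLinearMap)).mp
      hinj⟩
  exact ⟨AlgEquiv.ofBijective f hbij, fun a => by
    rw [AlgEquiv.ofBijective_apply, hf, one_smul]⟩

theorem charpoly_splittingRep_crossedProduct [DecidableEq Gal(E/F)]
    (i : E →ₐ[F] AlgebraicClosure F) (a : CrossedProduct hΦ) :
    (splittingRep F (CrossedProduct hΦ) a).charpoly = ((regularRep hΦ a).map i).charpoly := by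
  obtain ⟨f, hf⟩ := exists_splitting hΦ i
  rw [charpoly_splittingRep (by rw [card_gal, csaDegree_crossedProduct]) f, hf]

theorem trace_regularRep [DecidableEq Gal(E/F)] (a : CrossedProduct hΦ) :
    (regularRep hΦ a).trace = algebraMap F E (Algebra.trace F E (a 1 * (Φ (1, 1) : E))) := by
  rw [trace_eq_sum_automorphisms, Matrix.trace, ← Equiv.sum_comp (Equiv.inv _)]
  simp [regularRep_apply_diag]

theorem reducedTrace_crossedProduct (a : CrossedProduct hΦ) :
    reducedTrace F (CrossedProduct hΦ) a = Algebra.trace F E (a 1 * (Φ (1, 1) : E)) := by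
  classical
  let i : E →ₐ[F] AlgebraicClosure F := IsAlgClosed.lift
  have hd := csaDegree_crossedProduct hΦ
  have h1 : 1 ≤ csaDegree F (CrossedProduct hΦ) := hd ▸ finrank_pos
  have h2 : csaDegree F (CrossedProduct hΦ) - 1 = Fintype.card Gal(E/F) - 1 := by rw [hd, card_gal]
  change reducedCoeff F 1 a = _
  rw [reducedCoeff_of_le F h1, charpoly_splittingRep_crossedProduct hΦ i, h2, pow_one, neg_one_mul,
    ← map_neg, ← Matrix.trace_eq_neg_charpoly_coeff]
  have h3 : ((regularRep hΦ a).map i).trace = i ((regularRep hΦ a).trace) := by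
    simp [Matrix.trace]
  rw [h3, trace_regularRep, AlgHom.commutes, retractToBase_algebraMap]

theorem reducedSecondTrace_crossedProduct [DecidableEq Gal(E/F)] (i : E →ₐ[F] AlgebraicClosure F)
    (a : CrossedProduct hΦ) : reducedSecondTrace F (CrossedProduct hΦ) a =
      retractToBase F (i (minorSum univ (regularRep hΦ a))) := by
  have hd := csaDegree_crossedProduct hΦ
  change reducedCoeff F 2 a = _
  by_cases h : 2 ≤ finrank F E
  · rw [reducedCoeff_of_le F (hd ▸ h), charpoly_splittingRep_crossedProduct hΦ i, hd, ← card_gal,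
      charpoly_coeff_eq_minorSum _ (by rwa [card_gal])]
    have := minorSum_map (i : E →+* AlgebraicClosure F) univ (regularRep hΦ a)
    simp only [even_two, Even.neg_pow, one_pow, one_mul]
    exact congrArg _ this
  -- In degree one `t_2` is zero by convention, and there are no 2 × 2 minors.
  · rw [reducedCoeff, if_neg (hd ▸ h), minorSum_eq_zero_of_card_lt _ (by rw [card_gal]; omega)]
    simp

theorem polar_reducedSecondTrace (a b : CrossedProduct hΦ) :
    QuadraticMap.polar (reducedSecondTrace F (CrossedProduct hΦ)) a b =
      reducedTrace F _ a * reducedTrace F _ b - reducedTrace F _ (a * b) := by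
  classical
  let i : E →ₐ[F] AlgebraicClosure F := IsAlgClosed.lift
  have h (M N : Matrix Gal(E/F) Gal(E/F) E) : minorSum univ (M + N) - minorSum univ M -
      minorSum univ N = M.trace * N.trace - (M * N).trace := by
    rw [minorSum_add]
    simp only [Matrix.trace, Matrix.diag_apply, Matrix.mul_apply]
    ring
  simp only [QuadraticMap.polar, reducedSecondTrace_crossedProduct hΦ i, ← map_sub, map_add, h]
  rw [← map_mul (regularRep hΦ), trace_regularRep, trace_regularRep, trace_regularRep,
    ← map_mul (algebraMap F E), ← map_sub (algebraMap F E),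
    AlgHom.commutes, retractToBase_algebraMap]
  simp only [reducedTrace_crossedProduct]

/-- Multiplying by a multiple of `u σ⁻¹` moves the coefficient at `σ` to the identity component,
which reduces the claim to nondegeneracy of the trace form of `E/F`. -/
theorem nondegenerate_reducedTrace {a : CrossedProduct hΦ}
    (h : ∀ b, reducedTrace F _ (a * b) = 0) : a = 0 := by
  ext σ
  refine (traceForm_nondegenerate F E).1 _ fun c => ?_
  rw [Algebra.traceForm_apply]
  let u : E := Φ (σ, σ⁻¹) * Φ (1, 1)
  have hu : u ≠ 0 := by simp [u]
  have h1 := h (single hΦ σ⁻¹ (σ⁻¹ (c * u⁻¹)))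
  rw [reducedTrace_crossedProduct, mul_apply, Finset.sum_eq_single σ] at h1
  · simp only [mul_one, single_apply, if_true, AlgEquiv.aut_inv, AlgEquiv.apply_symm_apply] at h1
    rw [← h1]
    congr 1
    have : u⁻¹ * u = 1 := inv_mul_cancel₀ hu
    simp only [u, AlgEquiv.aut_inv] at this ⊢
    linear_combination (-a σ * c) * this
  · intro τ _ hτ
    simp [single_apply, hτ]
  · simp

/-- The reduced second trace of an element without cross terms. -/
theorem reducedSecondTrace_of_mul_inv [DecidableEq Gal(E/F)] {Q : QuadraticForm F E}
    (hQ : ∀ x, algebraMap F E (Q x) = secondSymm univ (conjugates F E x)) (a : CrossedProduct hΦ)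
    (ha : ∀ σ, σ ≠ 1 → a σ = 0 ∨ a σ⁻¹ = 0) :
    reducedSecondTrace F (CrossedProduct hΦ) a = Q (a 1 * (Φ (1, 1) : E)) := by
  rw [reducedSecondTrace_crossedProduct hΦ IsAlgClosed.lift, minorSum_eq_secondSymm]
  · have h : (fun σ => regularRep hΦ a σ σ) =
        conjugates F E (a 1 * (Φ (1, 1) : E)) ∘ Equiv.inv _ := by
      funext σ
      rw [regularRep_apply_diag]
      rfl
    rw [h, secondSymm_comp_equiv, ← hQ, AlgHom.commutes, retractToBase_algebraMap]
  · intro σ τ hστ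
    -- The two entries involve the coefficients at `στ⁻¹` and at its inverse `τσ⁻¹`, one of which is
    -- zero.
    rw [regularRep_apply, regularRep_apply]
    rcases ha (σ * τ⁻¹) (fun h => hστ (mul_inv_eq_one.mp h)) with h | h
    · simp [h]
    · rw [mul_inv_rev, inv_inv] at h
      simp [h]

end CrossedProduct

/-- In a group of odd order only `1` is its own inverse. Any enumeration of the group then selects
the smaller element of each pair `{σ, σ⁻¹}`. -/
theorem exists_half_of_odd_card {G : Type*} [Group G] [Fintype G] (h : Odd (Fintype.card G)) :
    ∃ S : Finset G, (∀ σ ∈ S, σ⁻¹ ∉ S) ∧ 2 * S.card + 1 = Fintype.card G := by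
  classical
  let e := Fintype.equivFin G
  let S := Finset.univ.filter fun σ : G => e σ < e σ⁻¹
  let S' := Finset.univ.filter fun σ : G => e σ⁻¹ < e σ
  have hS (σ : G) : σ ∈ S ↔ e σ < e σ⁻¹ := by simp [S]
  have hS' (σ : G) : σ ∈ S' ↔ e σ⁻¹ < e σ := by simp [S']
  have hinv (σ : G) (hσ : σ = σ⁻¹) : σ = 1 := by
    have h2 : σ ^ 2 = 1 := by rw [sq]; nth_rewrite 2 [hσ]; exact mul_inv_cancel σ
    have h3 := Nat.dvd_gcd (orderOf_dvd_of_pow_eq_one h2) (orderOf_dvd_card (x := σ))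
    rwa [Nat.Coprime.gcd_eq_one h.coprime_two_left, Nat.dvd_one, orderOf_eq_one_iff] at h3
  have hcard : S'.card = S.card := by
    refine Finset.card_bij (fun σ _ => σ⁻¹) ?_ ?_ ?_
    · intro σ hσ
      rw [hS, inv_inv]
      exact (hS' σ).mp hσ
    · intro σ _ τ _ hστ
      exact inv_injective hστ
    · intro σ hσ
      exact ⟨σ⁻¹, by rw [hS', inv_inv]; exact (hS σ).mp hσ, inv_inv σ⟩
  have hdisj : Disjoint S S' := Finset.disjoint_left.mpr fun σ h1 h2 =>
    lt_asymm ((hS σ).mp h1) ((hS' σ).mp h2)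
  have hone : 1 ∉ S ∪ S' := by simp [hS, hS']
  have huniv : insert 1 (S ∪ S') = Finset.univ := by
    ext σ
    simp only [Finset.mem_insert, Finset.mem_union, hS, hS', Finset.mem_univ, iff_true]
    rcases lt_trichotomy (e σ) (e σ⁻¹) with h | h | h
    · exact Or.inr (Or.inl h)
    · exact Or.inl (hinv σ (e.injective h))
    · exact Or.inr (Or.inr h)
  refine ⟨S, fun σ h1 h2 => ?_, ?_⟩
  · rw [hS, inv_inv] at h2
    exact lt_asymm ((hS σ).mp h1) h2
  · rw [← Finset.card_univ, ← huniv, Finset.card_insert_of_notMem hone,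
      Finset.card_union_of_disjoint hdisj, hcard]
    ring

/-! ### Splitting off the hyperbolic part of the second trace form -/

namespace CrossedProduct

open Module Finset

variable {F : Type u} {E : Type v} [Field F] [Field E] [Algebra F E] [FiniteDimensional F E]
  [IsGalois F E] {Φ : Gal(E/F) × Gal(E/F) → Eˣ} (hΦ : IsMulCocycle₂ Φ)

theorem mem_secondTraceSpace {m : ℕ} (hm : finrank F E = 2 * m + 1) (a : CrossedProduct hΦ) :
    a ∈ secondTraceSpace F (CrossedProduct hΦ) ↔
      Algebra.trace F E (a 1 * (Φ (1, 1) : E)) = 0 := by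
  have h : ¬ Even (finrank F E) := by simp [hm]
  rw [secondTraceSpace, csaDegree_crossedProduct, if_neg h, LinearMap.mem_ker,
    reducedTrace_crossedProduct]

theorem finrank_secondTraceSpace_add_one {m : ℕ} (hm : finrank F E = 2 * m + 1) :
    finrank F (secondTraceSpace F (CrossedProduct hΦ)) + 1 = finrank F E * finrank F E := by
  have h : ¬ Even (finrank F E) := by simp [hm]
  rw [secondTraceSpace, csaDegree_crossedProduct, if_neg h,
    Module.Dual.finrank_ker_add_one_of_ne_zero, finrank_crossedProduct]
  intro h0
  have h1 : (1 : CrossedProduct hΦ) = 0 :=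
    nondegenerate_reducedTrace hΦ fun b => by rw [h0, LinearMap.zero_apply]
  have h2 := congrArg (fun a : CrossedProduct hΦ => a 1) h1
  simp [one_def, single_apply] at h2

theorem nondegenerate_secondTraceForm [CharP F 2] {m : ℕ} (hm : finrank F E = 2 * m + 1) :
    (secondTraceForm F (CrossedProduct hΦ)).polarBilin.Nondegenerate := by
  refine nondegenerate_polarBilin fun a ha => Subtype.ext ?_
  have ha0 : reducedTrace F _ a.1 = 0 := by
    rw [reducedTrace_crossedProduct]
    exact (mem_secondTraceSpace hΦ hm _).mp a.2
  have hone : reducedTrace F (CrossedProduct hΦ) 1 = 1 := by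
    rw [reducedTrace_crossedProduct, one_def, single_apply, if_pos rfl, Units.inv_mul]
    rw [← map_one (algebraMap F E), Algebra.trace_algebraMap, nsmul_one,
      cast_eq_one_of_charTwo F hm]
  refine nondegenerate_reducedTrace hΦ fun b => ?_
  -- The reduced trace of `1` is `n = 1` in `F`, so this correction lands in the trace-zero space;
  -- it does not affect the pairing with `a`, whose reduced trace is zero.
  have h1 := ha ⟨b - reducedTrace F _ b • 1, by
    rw [mem_secondTraceSpace hΦ hm, ← reducedTrace_crossedProduct, map_sub, map_smul, hone]
    simp⟩
  rw [secondTraceForm,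
    ← polar_isometric (T := reducedSecondTrace F (CrossedProduct hΦ))
      (secondTraceSpace F _).subtype (fun _ => rfl),
    polar_reducedSecondTrace] at h1
  simpa [ha0, mul_sub] using h1

/-- The second trace form of a crossed product is the sum of the second trace form of the field
and a hyperbolic space. -/
theorem secondTraceForm_equivalent_conjugatesForm_prod [CharP F 2] [DecidableEq Gal(E/F)]
    {n m : ℕ} (hn : finrank F E = n) (hm : n = 2 * m + 1) {Q : QuadraticForm F E}
    (hQ : ∀ x, algebraMap F E (Q x) = secondSymm univ (conjugates F E x)) :
    (secondTraceForm F (CrossedProduct hΦ)).Equivalent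
      ((Q.comp (traceZero F E).subtype).prod (hyperbolicForm F (m * n))) := by
  have hnm := hn.trans hm
  obtain ⟨S, hS, hScard⟩ := exists_half_of_odd_card (G := Gal(E/F))
    (by rw [card_gal, hnm]; exact odd_two_mul_add_one m)
  have hS1 : (1 : Gal(E/F)) ∉ S := fun h => hS 1 h (by rwa [inv_one])
  rw [card_gal] at hScard
  -- The element `x` of `E` sits in the algebra as `x Φ(1,1)⁻¹ u_1`, since the unit is `Φ(1,1)⁻¹
  -- u_1`.
  let u : E := ((Φ (1, 1))⁻¹ : Eˣ)
  have hu (x : E) : x * u * (Φ (1, 1) : E) = x := by rw [mul_assoc, Units.inv_mul, mul_one]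
  let f : traceZero F E →ₗ[F] secondTraceSpace F (CrossedProduct hΦ) :=
    { toFun x := ⟨single hΦ 1 (x * u), by
        rw [mem_secondTraceSpace hΦ hnm, single_apply, if_pos rfl, hu]
        exact x.2⟩
      map_add' x y := by
        ext σ
        by_cases h : σ = 1 <;> simp [single_apply, h, add_mul]
      map_smul' c x := by
        ext σ
        by_cases h : σ = 1 <;> simp [single_apply, h] }
  have hf (x : traceZero F E) (σ : Gal(E/F)) :
      (f x : CrossedProduct hΦ) σ = if σ = 1 then x.1 * u else 0 := by
    convert single_apply (hΦ := hΦ) 1 σ (x.1 * u)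
    rfl
  -- The image `⨁_{σ ∈ S} E u_σ` is the required totally singular space: no `σ` and `σ⁻¹` are both
  -- in `S`, and the identity component is zero.
  let g : (S → E) →ₗ[F] secondTraceSpace F (CrossedProduct hΦ) :=
    { toFun y := ⟨(fun σ => if h : σ ∈ S then y ⟨σ, h⟩ else 0 : Gal(E/F) → E),
        (mem_secondTraceSpace hΦ hnm _).mpr (by
          rw [dif_neg hS1, zero_mul, map_zero])⟩
      map_add' x y := by
        refine Subtype.ext (funext fun σ => ?_)
        change (if h : σ ∈ S then (x + y) ⟨σ, h⟩ else 0) =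
          (if h : σ ∈ S then x ⟨σ, h⟩ else 0) + (if h : σ ∈ S then y ⟨σ, h⟩ else 0)
        by_cases h : σ ∈ S <;> simp [h]
      map_smul' c x := by
        refine Subtype.ext (funext fun σ => ?_)
        change (if h : σ ∈ S then (c • x) ⟨σ, h⟩ else 0) =
          c • (if h : σ ∈ S then x ⟨σ, h⟩ else 0)
        by_cases h : σ ∈ S <;> simp [h] }
  have hg (y : S → E) (σ : Gal(E/F)) :
      (g y : CrossedProduct hΦ) σ = if h : σ ∈ S then y ⟨σ, h⟩ else 0 := rfl
  have hginj : Function.Injective g := by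
    intro y y' h
    funext σ
    have h1 := congrArg (fun a : secondTraceSpace F (CrossedProduct hΦ) => a.1 σ.1) h
    simpa [hg] using h1
  have hT (x : traceZero F E) (y : S → E) :
      secondTraceForm F (CrossedProduct hΦ) (f x + g y) = Q x := by
    change reducedSecondTrace F (CrossedProduct hΦ) ((f x : CrossedProduct hΦ) + g y) = _
    rw [reducedSecondTrace_of_mul_inv hΦ hQ]
    · rw [add_apply, hf, hg, if_pos rfl, dif_neg hS1, add_zero, hu]
    · intro σ hσ
      have hσ' : σ⁻¹ ≠ 1 := inv_ne_one.mpr hσ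
      by_cases h : σ ∈ S
      · right
        rw [add_apply, hf, hg, if_neg hσ', dif_neg (hS σ h), add_zero]
      · left
        rw [add_apply, hf, hg, if_neg hσ, dif_neg h, add_zero]
  have hTf (x : traceZero F E) : secondTraceForm F (CrossedProduct hΦ) (f x) = Q x := by
    simpa using hT x 0
  have hTg (y : S → E) : secondTraceForm F (CrossedProduct hΦ) (g y) = 0 := by
    simpa using hT 0 y
  refine equivalent_prod_hyperbolicForm (nondegenerate_conjugatesForm hnm hQ)
    (nondegenerate_secondTraceForm hΦ hnm) f hTf (L := LinearMap.range g) ?_ ?_ ?_ ?_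
  · rintro _ ⟨y, rfl⟩
    exact hTg y
  · rintro x _ ⟨y, rfl⟩
    rw [QuadraticMap.polar, hT, hTf, hTg]
    simp
  · rw [LinearMap.finrank_range_of_inj hginj, finrank_pi_fintype, sum_const, card_univ,
      Fintype.card_coe, smul_eq_mul, hn]
    congr 1
    omega
  -- The count is `n² - 1 = (n - 1) + 2mn`.
  · have h1 := finrank_secondTraceSpace_add_one hΦ hnm
    have h2 := finrank_traceZero_add_one F E
    rw [hn] at h1 h2
    have h3 : n * n = 2 * (m * n) + n := by nth_rewrite 1 [hm]; ring
    omega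

end CrossedProduct

theorem corollary1 {F : Type u} {E : Type v} [Field F] [CharP F 2] [Field E] [Algebra F E]
    [FiniteDimensional F E] [IsGalois F E] (n m : ℕ) (hn : Module.finrank F E = n)
    (hm : n = 2 * m + 1) (Φ : Gal(E/F) × Gal(E/F) → Eˣ)
    (hΦ : groupCohomology.IsMulCocycle₂ Φ) :
    ((n % 8 = 1 ∨ n % 8 = 7) →
      WittEquivalent (secondTraceForm F (CrossedProduct hΦ)) (hyperbolicForm F m) ∧
      (secondTraceForm F (CrossedProduct hΦ)).Equivalent
        ((hyperbolicForm F m).prod (hyperbolicForm F (m * n)))) ∧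
    ((n % 8 = 3 ∨ n % 8 = 5) →
      WittEquivalent (secondTraceForm F (CrossedProduct hΦ))
        ((binaryForm (1 : F) 1).prod (hyperbolicForm F (m - 1))) ∧
      (secondTraceForm F (CrossedProduct hΦ)).Equivalent
        (((binaryForm (1 : F) 1).prod (hyperbolicForm F (m - 1))).prod
          (hyperbolicForm F (m * n)))) := by
  classical
  obtain ⟨Q, hQ⟩ := exists_conjugatesForm F E
  have h := CrossedProduct.secondTraceForm_equivalent_conjugatesForm_prod hΦ hn hm hQ
  constructor
  · intro hmod
    have h1 := h.trans (equivalent_prod_congr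
      (conjugatesForm_equivalent_of_one_or_seven hn hm hmod hQ) (QuadraticMap.Equivalent.refl _))
    exact ⟨wittEquivalent_of_equivalent_prod h1, h1⟩
  · intro hmod
    have h1 := h.trans (equivalent_prod_congr
      (conjugatesForm_equivalent_of_three_or_five hn hm hmod hQ) (QuadraticMap.Equivalent.refl _))
    exact ⟨wittEquivalent_of_equivalent_prod h1, h1⟩
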